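/- **Quartic Jacobi symbol.** For a prime $\pi$ of $\mathbb Z[i]$ of odd norm $N(\pi)$ and $\alpha\in\mathbb Z[i]$ put $\left(\frac{\alpha}{\pi}\right)_4=0$ if $\pi\mid\alpha$; otherwise $\left(\frac{\alpha}{\pi}\right)_4$ is the unique element of $\{1,i,-1,-i\}$ with $\alpha^{(N(\pi)-1)/4}\equiv\left(\frac{\alpha}{\pi}\right)_4 \pmod{\pi}$. For $\gamma\in\mathbb Z[i]$ of odd norm with prime factorization $\gamma=u\,\pi_1\cdots\pi_s$ ($u$ a unit) put $\left(\frac{\alpha}{\gamma}\right)_4=\prod_{j=1}^s\left(\frac{\alpha}{\pi_j}\right)_4$ (equal to $1$ if $\gamma$ is a unit). For a rational number $t=m/n$ in lowest terms with $n$ coprime to $\gamma$ put $\left(\frac{t+i}{\gamma}\right)_4=\left(\frac{m+ni}{\gamma}\right)_4\left(\frac{n}{\gamma}\right)_4^{-1}$. **Theorem.** Let $p\equiv 1\pmod 8$ be a prime and let $q\in\mathbb Z$ be odd (of either sign) with $p\nmid q$. Suppose $p=c^2+d^2=x^2+2qy^2$ with $c,d,x,y\in\mathbb Z$, $c\equiv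 1\pmod 4$, $d=2^rd_0$ with $r\ge 0$ an integer, $d_0\equiv 1\pmod 4$, and $\gcd(c,x+d)=1$. Let $k\in\mathbb Z$ and assume that $$\left(\frac{\frac{c}{x+d}+i}{q}\right)_4=i^k .$$ Then $$(-q)^{\frac{p-1}8}\equiv\begin{cases} (-1)^{\frac{q-1}8+\frac d4+\frac y2}\left(\frac dc\right)^{k}\pmod p&\text{if } q\equiv 1\pmod 8,\\[2pt] (-1)^{\frac{q-3}8+\frac{x-1}2}\left(\frac dc\right)^{k+1}\pmod p&\text{if } q\equiv 3\pmod 8,\\[2pt] (-1)^{\frac{q-5}8+\frac d4+\frac{x-1}2+\frac y2}\left(\frac dc\right)^{k-1}\pmod p&\text{if } q\equiv 5\pmod 8,\\[2pt] (-1)^{\frac{q+1}8}\left(\frac dc\right)^{k}\pmod p&\text{if } q\equiv 7\pmod 8. \end{cases}$$ Here $\frac dc$ is the quotient of $d$ by $c$ modulo $p$; the hypotheses imply $4\mid d$, $2\mid y$, $2\nmid x$ and $p\nmid cd$, so all exponents are integers. -/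

import Mathlib

noncomputable section

namespace QuarticJacobi

open Classical in
/-- The quartic residue symbol of a Gaussian integer `α` at a Gaussian prime `π` of odd norm `N`:
it is `0` if `π ∣ α`, and otherwise the unique power `i ^ r` with
`α ^ ((N - 1) / 4) ≡ i ^ r` modulo `π`. -/
def primeSymbol (α π : GaussianInt) : ℂ :=
  if π ∣ α then 0
  else if π ∣ α ^ (((Zsqrtd.norm π).natAbs - 1) / 4) - 1 then 1
  else if π ∣ α ^ (((Zsqrtd.norm π).natAbs - 1) / 4) - ⟨0, 1⟩ then Complex.I
  else if π ∣ α ^ (((Zsqrtd.norm π).natAbs - 1) / 4) - (-1) then -1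
  else if π ∣ α ^ (((Zsqrtd.norm π).natAbs - 1) / 4) - ⟨0, -1⟩ then -Complex.I
  else 0

/-- The quartic Jacobi symbol of `α` modulo a Gaussian integer `γ` of odd norm: the product of the
quartic residue symbols at the prime factors of `γ`, taken with multiplicity. The prime symbol
does not change if the prime is multiplied by a unit, so the choice of the factors within their
classes of associates is immaterial. The symbol modulo a unit is `1`. -/
def symbol (α γ : GaussianInt) : ℂ :=
  ((UniqueFactorizationMonoid.factors γ).map (primeSymbol α)).prod

/-- The quartic Jacobi symbol of `t + i`, for a rational number `t`, modulo `γ`, by multiplicativity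
in the argument: for `t = m / n` in lowest terms, `t + i = (m + n i) / n`. It is meant for `n`
coprime to `γ`; otherwise its value is `0`. -/
def symbolAddI (t : ℚ) (γ : GaussianInt) : ℂ :=
  symbol ⟨t.num, (t.den : ℤ)⟩ γ / symbol ⟨(t.den : ℤ), 0⟩ γ

end QuarticJacobi

end

/-! Put `π = c + d i` and `γ = c + (x + d) i = (1 + i) g`. The reciprocity law for a rational
modulus, obtained from Gauss and Jacobi sums, turns `(γ / q)₄` into a power of `i` times
`(-q / g)₄`. Since `N(g) = x (x + d) + q y²` and `γ² ≡ 2 i (x + d) π` modulo every divisor of `y`,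
the same law gives `(x / π)₄ = i ^ a (-q / g)₄ (y / π)₄` with an explicit `a`. Now `x² ≡ -2 q y²`
modulo `p`, and `2 ^ ((p - 1) / 8)` is known from `(c + d)² ≡ 2 i c²` modulo `π`; so if
`(-q / g)₄ = i ^ e`, then `(-q) ^ ((p - 1) / 8) ≡ (d / c) ^ e` modulo `p`. This assumes
`x ≡ 1 (mod 4)`; otherwise conjugate the symbols, which replaces `(x, d, k)` by `(-x, -d, -k)`.
-/

namespace QuarticJacobi

open GaussianInt UniqueFactorizationMonoid

section Norm

variable {a b γ : GaussianInt}

lemma norm_dvd_norm (h : a ∣ b) : a.norm ∣ b.norm :=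
  map_dvd Zsqrtd.normMonoidHom h

lemma isUnit_iff_norm_eq_one : IsUnit a ↔ a.norm = 1 :=
  (Zsqrtd.norm_eq_one_iff' (by norm_num) a).symm

lemma isUnit_iff : IsUnit a ↔ a = 1 ∨ a = -1 ∨ a = ⟨0, 1⟩ ∨ a = ⟨0, -1⟩ := by
  rw [isUnit_iff_norm_eq_one]
  constructor
  · obtain ⟨u, v⟩ := a
    intro h
    have e : u * u + v * v = 1 := by rw [← h, Zsqrtd.norm]; ring
    have hu : -1 ≤ u ∧ u ≤ 1 := by constructor <;> nlinarith [mul_self_nonneg v]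
    have hv : -1 ≤ v ∧ v ≤ 1 := by constructor <;> nlinarith [mul_self_nonneg u]
    obtain ⟨hu₁, hu₂⟩ := hu
    obtain ⟨hv₁, hv₂⟩ := hv
    interval_cases u <;> interval_cases v <;> first | omega | decide
  · rintro (rfl | rfl | rfl | rfl) <;> decide

lemma pow_four_of_isUnit (h : IsUnit a) : a ^ 4 = 1 := by
  rcases isUnit_iff.1 h with rfl | rfl | rfl | rfl <;> decide

lemma isPrimitiveRoot_I : IsPrimitiveRoot (⟨0, 1⟩ : GaussianInt) 4 :=
  IsPrimitiveRoot.mk_of_lt _ (by norm_num) (by decide) fun l h₁ h₂ => by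
    interval_cases l <;> decide

lemma toComplex_I : toComplex ⟨0, 1⟩ = Complex.I := by simp [toComplex_def']

lemma toComplex_neg_I : toComplex ⟨0, -1⟩ = -Complex.I := by simp [toComplex_def']

lemma odd_norm_iff : Odd γ.norm ↔ Odd (γ.re + γ.im) := by
  simp only [Zsqrtd.norm]
  rw [Int.odd_sub, Int.odd_add, Int.odd_mul, Int.even_mul, Int.even_mul]
  simp [← Int.not_odd_iff_even]

lemma odd_norm_of_dvd (h : a ∣ b) (hb : Odd b.norm) : Odd a.norm := by
  obtain ⟨c, rfl⟩ := h
  rw [Zsqrtd.norm_mul] at hb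
  exact Int.Odd.of_mul_left hb

lemma odd_norm_intCast {m : ℤ} (hm : Odd m) : Odd (m : GaussianInt).norm := by
  rw [Zsqrtd.norm_intCast]
  exact hm.mul hm

lemma odd_norm_natCast {m : ℕ} (hm : Odd m) : Odd (m : GaussianInt).norm := by
  exact_mod_cast odd_norm_intCast (m := m) (by exact_mod_cast hm)

lemma ne_zero_of_odd_norm (h : Odd a.norm) : a ≠ 0 := by
  rintro rfl
  simp at h

/-- The exponent `(N - 1) / 4` in the definition of the quartic residue symbol. -/
def symbolExponent (π : GaussianInt) : ℕ := (π.norm.natAbs - 1) / 4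

lemma natAbs_norm_eq (h : Odd a.norm) : a.norm.natAbs = 4 * symbolExponent a + 1 := by
  have hmod : a.norm % 4 = 1 := by
    have e : a.norm = a.re ^ 2 + a.im ^ 2 := by rw [Zsqrtd.norm]; ring
    rw [odd_norm_iff, Int.odd_add] at h
    rw [e]
    rcases Int.even_or_odd a.re with hr | hr
    · obtain ⟨m, hm⟩ := hr
      obtain ⟨n, hn⟩ := Int.not_even_iff_odd.1 (mt h.2 (Int.not_odd_iff_even.2 ⟨m, hm⟩))
      rw [hm, hn]
      ring_nf
      omega
    · obtain ⟨n, hn⟩ := h.1 hr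
      obtain ⟨m, hm⟩ := hr
      rw [hm, hn]
      ring_nf
      omega
  have := norm_nonneg a
  unfold symbolExponent
  omega

lemma norm_eq (h : Odd a.norm) : a.norm = 4 * symbolExponent a + 1 := by
  rw [← abs_natCast_norm, natAbs_norm_eq h]
  push_cast
  rfl

lemma symbolExponent_mul (ha : Odd a.norm) (hb : Odd b.norm) :
    symbolExponent (a * b) =
      4 * (symbolExponent a * symbolExponent b) + symbolExponent a + symbolExponent b := by
  have h := natAbs_norm_eq (Zsqrtd.norm_mul a b ▸ ha.mul hb)
  rw [Zsqrtd.norm_mul, Int.natAbs_mul, natAbs_norm_eq ha, natAbs_norm_eq hb] at h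
  linarith

lemma symbolExponent_pos (h : Odd a.norm) (hu : ¬ IsUnit a) : 0 < symbolExponent a := by
  have := norm_eq h
  rw [isUnit_iff_norm_eq_one] at hu
  omega

lemma isCoprime_one_add_I (hγ : Odd γ.norm) : IsCoprime (⟨1, 1⟩ : GaussianInt) γ := by
  obtain ⟨k, hk⟩ := hγ
  refine ⟨-k * ⟨1, -1⟩, star γ, ?_⟩
  rw [mul_comm (star γ), ← Zsqrtd.norm_eq_mul_conj, hk, mul_assoc,
    show (⟨1, -1⟩ : GaussianInt) * ⟨1, 1⟩ = 2 by decide]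
  push_cast
  ring

end Norm

section Residue

variable {R : Type*} [CommRing R] (φ : GaussianInt →+* R) {p : ℕ} [Fact p.Prime]

lemma map_eq_zero_iff_dvd [Nontrivial R] {φ : GaussianInt →+* R} {π : GaussianInt} (hπ : Prime π)
    (h0 : φ π = 0) {α : GaussianInt} : φ α = 0 ↔ π ∣ α := by
  refine ⟨fun h => ?_, fun h => zero_dvd_iff.1 (h0 ▸ map_dvd φ h)⟩
  by_contra hd
  obtain ⟨a, b, hab⟩ := ((hπ.irreducible.coprime_iff_not_dvd).2 hd).map φ
  simp [h0, h] at hab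

lemma exists_residue_field {π : GaussianInt} (hπ : Prime π) :
    ∃ (F : Type) (_ : Field F) (φ : GaussianInt →+* F), φ π = 0 := by
  have := PrincipalIdealRing.isMaximal_of_irreducible hπ.irreducible
  exact ⟨_, Ideal.Quotient.field (Ideal.span {π}), Ideal.Quotient.mk _,
    Ideal.Quotient.eq_zero_iff_mem.2 (Ideal.mem_span_singleton_self π)⟩

lemma map_pow_char [CharP R p] (α : GaussianInt) :
    φ α ^ p = α.re + α.im * φ ⟨0, 1⟩ ^ p := by
  have hα : φ α = α.re + α.im * φ ⟨0, 1⟩ := by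
    rw [← map_intCast φ, ← map_intCast φ, ← map_mul, ← map_add]
    congr 1
    ext <;> simp
  simpa only [frobenius_def, map_add, map_mul, map_intCast] using congrArg (frobenius R p) hα

lemma map_pow_char_of_mod_four_eq_one [CharP R p] (h : p % 4 = 1) (α : GaussianInt) :
    φ α ^ p = φ α := by
  rw [map_pow_char, ← map_pow, ← Nat.div_add_mod p 4, h, pow_succ, pow_mul,
    isPrimitiveRoot_I.pow_eq_one, one_pow, one_mul, ← map_intCast φ, ← map_intCast φ, ← map_mul,
    ← map_add]
  congr 1
  ext <;> simp

lemma map_pow_char_of_mod_four_eq_three [CharP R p] (h : p % 4 = 3) (α : GaussianInt) :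
    φ α ^ p = φ (star α) := by
  rw [map_pow_char, ← map_pow, ← Nat.div_add_mod p 4, h, pow_add, pow_mul,
    isPrimitiveRoot_I.pow_eq_one, one_pow, one_mul, show (⟨0, 1⟩ : GaussianInt) ^ 3 = ⟨0, -1⟩ by
      decide, ← map_intCast φ, ← map_intCast φ, ← map_mul, ← map_add]
  congr 1
  ext <;> simp

lemma exists_prime_dvd_natCast {π : GaussianInt} (hπ : Prime π) :
    ∃ p : ℕ, p.Prime ∧ π ∣ p := by
  obtain ⟨F, _, φ, h0⟩ := exists_residue_field hπ
  obtain ⟨p, hp⟩ := CharP.exists F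
  refine ⟨p, (CharP.char_is_prime_or_zero F p).resolve_right ?_, ?_⟩
  · rintro rfl
    have := CharP.charP_to_charZero F
    have hN : (π.norm : F) = 0 := by
      rw [← map_intCast φ, Zsqrtd.norm_eq_mul_conj, map_mul, h0, zero_mul]
    exact hπ.ne_zero ((Zsqrtd.norm_eq_zero_iff (by norm_num) π).1 (by exact_mod_cast hN))
  · rw [← map_eq_zero_iff_dvd hπ h0, map_natCast, CharP.cast_eq_zero]

lemma inert_or_split_of_prime {π : GaussianInt} (hπ : Prime π) (ho : Odd π.norm) :
    (∃ p : ℕ, p.Prime ∧ p % 4 = 3 ∧ Associated π p) ∨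
      ∃ p : ℕ, p.Prime ∧ p % 4 = 1 ∧ π.norm = p := by
  obtain ⟨p, hp, hd⟩ := exists_prime_dvd_natCast hπ
  have : Fact p.Prime := ⟨hp⟩
  have hN := norm_eq ho
  obtain ⟨k, hk, hNk⟩ : ∃ k ≤ 2, π.norm.natAbs = p ^ k := by
    have := norm_dvd_norm hd
    rw [Zsqrtd.norm_natCast, ← sq] at this
    exact (Nat.dvd_prime_pow hp).1 (by simpa [Int.natAbs_pow] using Int.natAbs_dvd_natAbs.2 this)
  interval_cases k
  · rw [pow_zero] at hNk
    exact absurd (isUnit_iff_norm_eq_one.2 (by omega)) hπ.not_isUnit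
  · rw [pow_one] at hNk
    exact .inr ⟨p, hp, by omega, by omega⟩
  · obtain ⟨w, hw⟩ := hd
    have hw1 : w.norm = 1 := by
      have := congrArg Zsqrtd.norm hw
      rw [Zsqrtd.norm_mul, Zsqrtd.norm_natCast, ← abs_natCast_norm π, hNk] at this
      push_cast at this
      exact mul_left_cancel₀ (pow_ne_zero 2 (Nat.cast_ne_zero.2 hp.ne_zero))
        (by rw [← this]; ring)
    have has : Associated π (p : GaussianInt) := ⟨(isUnit_iff_norm_eq_one.2 hw1).unit, hw.symm⟩
    exact .inl ⟨p, hp, (prime_iff_mod_four_eq_three_of_nat_prime p).1 (has.prime hπ), has⟩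

lemma dvd_pow_norm_sub_self {π : GaussianInt} (hπ : Prime π) (ho : Odd π.norm) (α : GaussianInt) :
    π ∣ α ^ π.norm.natAbs - α := by
  obtain ⟨F, _, φ, h0⟩ := exists_residue_field hπ
  rw [← map_eq_zero_iff_dvd hπ h0, map_sub, sub_eq_zero, map_pow]
  have charP_of_dvd {p : ℕ} (hp : p.Prime) (hd : π ∣ p) : CharP F p :=
    (CharP.charP_iff_prime_eq_zero hp).2 (by
      rw [← map_natCast φ, map_eq_zero_iff_dvd hπ h0]; exact hd)
  rcases inert_or_split_of_prime hπ ho with ⟨p, hp, h3, has⟩ | ⟨p, hp, h1, hN⟩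
  · have : Fact p.Prime := ⟨hp⟩
    have := charP_of_dvd hp has.dvd
    rw [Zsqrtd.norm_eq_of_associated (by norm_num) has, Zsqrtd.norm_natCast, Int.natAbs_mul,
      Int.natAbs_natCast, pow_mul, map_pow_char_of_mod_four_eq_three φ h3,
      map_pow_char_of_mod_four_eq_three φ h3, star_star]
  · have : Fact p.Prime := ⟨hp⟩
    have := charP_of_dvd hp ⟨star π, by rw [← Zsqrtd.norm_eq_mul_conj, hN, Int.cast_natCast]⟩
    rw [hN, Int.natAbs_natCast, map_pow_char_of_mod_four_eq_one φ h1]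

end Residue

section PrimeSymbol

/-- The values of the quartic residue symbol, as Gaussian integers: zero and the units
`±1`, `±i`. -/
def IsQuarticValue (z : GaussianInt) : Prop :=
  z = 0 ∨ IsUnit z

variable {z w π α β : GaussianInt}

lemma IsQuarticValue.mul (hz : IsQuarticValue z) (hw : IsQuarticValue w) :
    IsQuarticValue (z * w) := by
  rcases hz with rfl | hz
  · exact .inl (zero_mul w)
  · rcases hw with rfl | hw
    · exact .inl (mul_zero z)
    · exact .inr (hz.mul hw)

lemma IsQuarticValue.pow {z : GaussianInt} (hz : IsQuarticValue z) (n : ℕ) :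
    IsQuarticValue (z ^ n) := by
  induction n with
  | zero => exact .inr (pow_zero z ▸ isUnit_one)
  | succ n ih => exact pow_succ z n ▸ ih.mul hz

lemma IsQuarticValue.star (hz : IsQuarticValue z) : IsQuarticValue (star z) := by
  rcases hz with rfl | hz
  · exact .inl (star_zero _)
  · exact .inr hz.star

lemma IsQuarticValue.sub_norm_dvd_four (hz : IsQuarticValue z) (hw : IsQuarticValue w)
    (h : z ≠ w) : (z - w).norm ∣ 4 := by
  rw [IsQuarticValue, isUnit_iff] at hz hw
  rcases hz with rfl | rfl | rfl | rfl | rfl <;> rcases hw with rfl | rfl | rfl | rfl | rfl <;>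
    first
    | exact absurd rfl h
    | decide

lemma IsQuarticValue.eq_of_dvd_sub (hz : IsQuarticValue z) (hw : IsQuarticValue w)
    (hu : ¬ IsUnit π) (ho : Odd π.norm) (h : π ∣ z - w) : z = w := by
  by_contra hne
  have hle := Int.le_of_dvd (by norm_num) ((norm_dvd_norm h).trans (hz.sub_norm_dvd_four hw hne))
  have hN := norm_eq ho
  have hpos := symbolExponent_pos ho hu
  omega

lemma exists_isQuarticValue_dvd_sub (hπ : Prime π) (ho : Odd π.norm) (α : GaussianInt) :
    ∃ z, IsQuarticValue z ∧ π ∣ α ^ symbolExponent π - z := by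
  have h := dvd_pow_norm_sub_self hπ ho α
  set t := α ^ symbolExponent π with ht
  have hfactor : α ^ π.norm.natAbs - α =
      α * ((t - 1) * ((t - -1) * ((t - ⟨0, 1⟩) * (t - ⟨0, -1⟩)))) := by
    have hI : (⟨0, 1⟩ : GaussianInt) ^ 2 = -1 := by decide
    rw [natAbs_norm_eq ho, show (⟨0, -1⟩ : GaussianInt) = -⟨0, 1⟩ by decide, pow_succ, mul_comm 4,
      pow_mul, ← ht]
    linear_combination (α * (t - 1) * (t + 1)) * hI
  rw [hfactor] at h
  rcases hπ.dvd_or_dvd h with h | h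
  · exact ⟨0, .inl rfl, by
      simpa [ht] using h.trans (dvd_pow_self _ (symbolExponent_pos ho hπ.not_isUnit).ne')⟩
  rcases hπ.dvd_or_dvd h with h | h
  · exact ⟨_, .inr (isUnit_iff.2 (by simp)), h⟩
  rcases hπ.dvd_or_dvd h with h | h
  · exact ⟨_, .inr (isUnit_iff.2 (by simp)), h⟩
  rcases hπ.dvd_or_dvd h with h | h <;>
    exact ⟨_, .inr (isUnit_iff.2 (by simp)), h⟩

lemma primeSymbol_eq_toComplex (hπ : Prime π) (ho : Odd π.norm) (hz : IsQuarticValue z)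
    (h : π ∣ α ^ symbolExponent π - z) : primeSymbol α π = toComplex z := by
  have hpos := symbolExponent_pos ho hπ.not_isUnit
  have eq_of_dvd : ∀ w, IsQuarticValue w → π ∣ α ^ symbolExponent π - w → z = w :=
    fun w hw hd => hz.eq_of_dvd_sub hw hπ.not_isUnit ho (by simpa using dvd_sub hd h)
  unfold primeSymbol
  rw [← symbolExponent]
  split_ifs with h0 h1 hI hn1 hnI
  · rw [eq_of_dvd 0 (.inl rfl) (by simpa using h0.trans (dvd_pow_self _ hpos.ne')), map_zero]
  · rw [eq_of_dvd 1 (.inr isUnit_one) h1, map_one]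
  · rw [eq_of_dvd _ (.inr (isUnit_iff.2 (by simp))) hI, toComplex_I]
  · rw [eq_of_dvd _ (.inr isUnit_one.neg) hn1, map_neg, map_one]
  · rw [eq_of_dvd _ (.inr (isUnit_iff.2 (by simp))) hnI, toComplex_neg_I]
  · rw [IsQuarticValue, isUnit_iff] at hz
    rcases hz with rfl | rfl | rfl | rfl | rfl
    · rw [map_zero]
    all_goals contradiction

lemma primeSymbol_eq_of_map_pow_eq {R : Type*} [CommRing R] [Nontrivial R] {φ : GaussianInt →+* R}
    (hπ : Prime π) (ho : Odd π.norm) (h0 : φ π = 0) (hz : IsQuarticValue z)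
    (h : φ α ^ symbolExponent π = φ z) : primeSymbol α π = toComplex z :=
  primeSymbol_eq_toComplex hπ ho hz ((map_eq_zero_iff_dvd hπ h0).1 (by
    rw [map_sub, map_pow, h, sub_self]))

lemma primeSymbol_mul_left (hπ : Prime π) (ho : Odd π.norm) (α β : GaussianInt) :
    primeSymbol (α * β) π = primeSymbol α π * primeSymbol β π := by
  obtain ⟨z, hz, h⟩ := exists_isQuarticValue_dvd_sub hπ ho α
  obtain ⟨w, hw, h'⟩ := exists_isQuarticValue_dvd_sub hπ ho β
  rw [primeSymbol_eq_toComplex hπ ho hz h, primeSymbol_eq_toComplex hπ ho hw h', ← map_mul]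
  refine primeSymbol_eq_toComplex hπ ho (hz.mul hw) ?_
  rw [mul_pow]
  exact dvd_mul_sub_mul h h'

lemma primeSymbol_congr (hπ : Prime π) (ho : Odd π.norm) (h : π ∣ α - β) :
    primeSymbol α π = primeSymbol β π := by
  obtain ⟨z, hz, h'⟩ := exists_isQuarticValue_dvd_sub hπ ho β
  rw [primeSymbol_eq_toComplex hπ ho hz h']
  refine primeSymbol_eq_toComplex hπ ho hz ?_
  simpa using dvd_add (h.trans (sub_dvd_pow_sub_pow α β (symbolExponent π))) h'

lemma primeSymbol_of_associated {ρ : GaussianInt} (h : Associated π ρ) (α : GaussianInt) :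
    primeSymbol α π = primeSymbol α ρ := by
  classical
  simp only [primeSymbol, Zsqrtd.norm_eq_of_associated (by norm_num) h, h.dvd_iff_dvd_left]

lemma prime_star (hπ : Prime π) : Prime (star π) :=
  (MulEquiv.prime_iff (starRingAut (R := GaussianInt)).toMulEquiv (p := π)).2 hπ

lemma primeSymbol_star (hπ : Prime π) (ho : Odd π.norm) (α : GaussianInt) :
    primeSymbol (star α) (star π) = star (primeSymbol α π) := by
  obtain ⟨z, hz, h⟩ := exists_isQuarticValue_dvd_sub hπ ho α
  have hN : (star π).norm = π.norm := Zsqrtd.norm_conj π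
  rw [primeSymbol_eq_toComplex hπ ho hz h,
    primeSymbol_eq_toComplex (prime_star hπ) (by rwa [hN]) hz.star]
  · exact toComplex_star z
  · rw [symbolExponent, hN, ← star_pow, ← star_sub]
    exact map_dvd (starRingEnd GaussianInt) h

end PrimeSymbol

section Symbol

variable {α β γ δ π : GaussianInt}

lemma map_primeSymbol_eq_of_rel {s t : Multiset GaussianInt} (h : Multiset.Rel Associated s t)
    (α : GaussianInt) : s.map (primeSymbol α) = t.map (primeSymbol α) := by
  rw [← Multiset.rel_eq, Multiset.rel_map]
  exact h.mono fun a _ b _ hab => primeSymbol_of_associated hab α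

lemma odd_norm_of_mem_factors (hγ : Odd γ.norm) (h : π ∈ factors γ) : Odd π.norm :=
  odd_norm_of_dvd (dvd_of_mem_factors h) hγ

lemma symbol_mul_left (hγ : Odd γ.norm) (α β : GaussianInt) :
    symbol (α * β) γ = symbol α γ * symbol β γ := by
  rw [symbol, symbol, symbol, ← Multiset.prod_map_mul]
  exact congrArg _ (Multiset.map_congr rfl fun π hπ =>
    primeSymbol_mul_left (prime_of_factor π hπ) (odd_norm_of_mem_factors hγ hπ) α β)

lemma symbol_congr (hγ : Odd γ.norm) (h : γ ∣ α - β) : symbol α γ = symbol β γ :=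
  congrArg _ (Multiset.map_congr rfl fun π hπ =>
    primeSymbol_congr (prime_of_factor π hπ) (odd_norm_of_mem_factors hγ hπ)
      ((dvd_of_mem_factors hπ).trans h))

lemma symbol_mul_right (hγ : γ ≠ 0) (hδ : δ ≠ 0) (α : GaussianInt) :
    symbol α (γ * δ) = symbol α γ * symbol α δ := by
  rw [symbol, map_primeSymbol_eq_of_rel (factors_mul hγ hδ), Multiset.map_add, Multiset.prod_add]
  rfl

lemma symbol_of_associated (h : Associated γ δ) (α : GaussianInt) : symbol α γ = symbol α δ := by
  rw [symbol, map_primeSymbol_eq_of_rel (factors_rel_of_associated h)]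
  rfl

lemma symbol_neg_right (α γ : GaussianInt) : symbol α (-γ) = symbol α γ :=
  symbol_of_associated (Associated.neg_left (Associated.refl _)) α

lemma symbol_of_isUnit (h : IsUnit γ) (α : GaussianInt) : symbol α γ = 1 := by
  simp [symbol, factors_of_isUnit h]

lemma symbol_of_prime (h : Prime π) (α : GaussianInt) : symbol α π = primeSymbol α π := by
  obtain ⟨ρ, hρ, hf⟩ := factors_eq_singleton_of_irreducible h.irreducible
  simp [symbol, hf, primeSymbol_of_associated hρ]

lemma induction_on_odd_norm {P : (γ : GaussianInt) → Odd γ.norm → Prop}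
    (unit : ∀ u (hu : IsUnit u), P u (by rw [isUnit_iff_norm_eq_one.1 hu]; exact odd_one))
    (mul : ∀ γ δ (hγ : Odd γ.norm) (hδ : Odd δ.norm), P γ hγ → P δ hδ →
      P (γ * δ) (Zsqrtd.norm_mul γ δ ▸ hγ.mul hδ))
    (prime : ∀ π (ho : Odd π.norm), Prime π → P π ho) (hγ : Odd γ.norm) : P γ hγ := by
  revert hγ
  refine induction_on_prime γ (fun h => absurd rfl (ne_zero_of_odd_norm h))
    (fun u h _ => unit u h) fun γ π _ hπ ih h => ?_
  have hodd := h
  rw [Zsqrtd.norm_mul, Int.odd_mul] at hodd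
  exact mul π γ hodd.1 hodd.2 (prime π hodd.1 hπ) (ih hodd.2)

lemma symbol_star (hγ : Odd γ.norm) (α : GaussianInt) :
    symbol (star α) (star γ) = star (symbol α γ) := by
  induction hγ using induction_on_odd_norm with
  | unit u h => rw [symbol_of_isUnit h, symbol_of_isUnit h.star, star_one]
  | mul γ δ hγ hδ ihγ ihδ =>
    have hγ := ne_zero_of_odd_norm hγ
    have hδ := ne_zero_of_odd_norm hδ
    rw [star_mul', symbol_mul_right (star_ne_zero.2 hγ) (star_ne_zero.2 hδ), ihγ, ihδ,
      symbol_mul_right hγ hδ, star_mul']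
  | prime π ho hπ =>
    rw [symbol_of_prime hπ, symbol_of_prime (prime_star hπ), primeSymbol_star hπ ho]

lemma symbol_ne_zero (hγ : Odd γ.norm) (h : IsCoprime α γ) : symbol α γ ≠ 0 := by
  intro h0
  obtain ⟨π, hπ, h0⟩ := Multiset.mem_map.1 (Multiset.prod_eq_zero_iff.1 h0)
  have hp := prime_of_factor π hπ
  have ho := odd_norm_of_mem_factors hγ hπ
  obtain ⟨z, hz, hd⟩ := exists_isQuarticValue_dvd_sub hp ho α
  rw [primeSymbol_eq_toComplex hp ho hz hd, toComplex_eq_zero] at h0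
  rw [h0, sub_zero] at hd
  exact hp.not_isUnit (h.isUnit_of_dvd' (hp.dvd_of_dvd_pow hd) (dvd_of_mem_factors hπ))

lemma symbol_eq_zero (hγ : Odd γ.norm) (h : ¬ IsCoprime α γ) : symbol α γ = 0 := by
  have h0 := ne_zero_of_odd_norm hγ
  obtain ⟨π, hπ, hα, hdvd⟩ : ∃ π, Prime π ∧ π ∣ α ∧ π ∣ γ := by
    by_contra! hc
    exact h (isCoprime_of_prime_dvd (fun h => h0 h.2) hc)
  obtain ⟨ρ, hρ, has⟩ := exists_mem_factors_of_dvd h0 hπ.irreducible hdvd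
  exact Multiset.prod_eq_zero (Multiset.mem_map.2 ⟨ρ, hρ, if_pos (has.symm.dvd.trans hα)⟩)

lemma symbol_one_left (hγ : Odd γ.norm) : symbol 1 γ = 1 := by
  have h := symbol_mul_left hγ 1 1
  rw [mul_one] at h
  exact (mul_eq_left₀ (symbol_ne_zero hγ isCoprime_one_left)).1 h.symm

lemma symbol_pow_left (hγ : Odd γ.norm) (α : GaussianInt) (n : ℕ) :
    symbol (α ^ n) γ = symbol α γ ^ n := by
  induction n with
  | zero => rw [pow_zero, pow_zero, symbol_one_left hγ]
  | succ n ih => rw [pow_succ, symbol_mul_left hγ, ih, pow_succ]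

lemma symbol_pow_four (hγ : Odd γ.norm) (h : IsCoprime α γ) : symbol α γ ^ 4 = 1 := by
  induction hγ using induction_on_odd_norm with
  | unit u hu => rw [symbol_of_isUnit hu, one_pow]
  | mul γ δ hγ hδ ihγ ihδ =>
    rw [symbol_mul_right (ne_zero_of_odd_norm hγ) (ne_zero_of_odd_norm hδ), mul_pow,
      ihγ h.of_mul_right_left, ihδ h.of_mul_right_right, mul_one]
  | prime π ho hπ =>
    have h0 := symbol_ne_zero ho h
    obtain ⟨z, hz, hd⟩ := exists_isQuarticValue_dvd_sub hπ ho α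
    rw [symbol_of_prime hπ, primeSymbol_eq_toComplex hπ ho hz hd] at h0 ⊢
    have hu : IsUnit z := hz.resolve_left fun h => h0 (by rw [h, map_zero])
    rw [← map_pow, pow_four_of_isUnit hu, map_one]

lemma I_zpow_eq_iff {a b : ℤ} : Complex.I ^ a = Complex.I ^ b ↔ a ≡ b [ZMOD 4] := by
  rw [← div_eq_one_iff_eq (zpow_ne_zero b Complex.I_ne_zero), ← zpow_sub₀ Complex.I_ne_zero,
    Complex.isPrimitiveRoot_I.zpow_eq_one_iff_dvd, Int.modEq_comm, Int.modEq_iff_dvd]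
  rfl

lemma symbol_I_left (hγ : Odd γ.norm) : symbol ⟨0, 1⟩ γ = Complex.I ^ symbolExponent γ := by
  induction hγ using induction_on_odd_norm with
  | unit u h =>
    rw [symbol_of_isUnit h, symbolExponent, isUnit_iff_norm_eq_one.1 h]
    simp
  | mul γ δ hγ hδ ihγ ihδ =>
    rw [symbol_mul_right (ne_zero_of_odd_norm hγ) (ne_zero_of_odd_norm hδ), ihγ, ihδ,
      symbolExponent_mul hγ hδ, pow_add, pow_add, pow_mul, Complex.I_pow_four, one_pow, one_mul]
  | prime π ho hπ =>
    have hu : IsUnit (⟨0, 1⟩ : GaussianInt) := isUnit_iff.2 (by simp)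
    rw [symbol_of_prime hπ, primeSymbol_eq_toComplex hπ ho (.inr (hu.pow (symbolExponent π)))
      (by rw [sub_self]; exact dvd_zero _), map_pow, toComplex_I]

lemma symbol_neg_one_left (hγ : Odd γ.norm) : symbol (-1) γ = (-1) ^ symbolExponent γ := by
  rw [show (-1 : GaussianInt) = ⟨0, 1⟩ * ⟨0, 1⟩ by decide, symbol_mul_left hγ, symbol_I_left hγ,
    ← mul_pow, Complex.I_mul_I]

lemma symbol_neg_one_mul_self (hγ : Odd γ.norm) : symbol (-1) γ * symbol (-1) γ = 1 := by
  rw [← symbol_mul_left hγ, neg_mul_neg, one_mul, symbol_one_left hγ]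

lemma symbol_two_sq (hγ : Odd γ.norm) : symbol 2 γ ^ 2 = symbol (-1) γ := by
  have h := symbol_pow_four hγ (isCoprime_one_add_I hγ)
  rw [← symbol_pow_left hγ, show (⟨1, 1⟩ : GaussianInt) ^ 4 = (-1) * 2 ^ 2 by decide,
    symbol_mul_left hγ, symbol_pow_left hγ] at h
  linear_combination symbol (-1) γ * h - symbol 2 γ ^ 2 * symbol_neg_one_mul_self hγ

end Symbol

section RationalInteger

lemma IsQuarticValue.eq_of_map_eq {R : Type*} [CommRing R] [IsDomain R] (h2 : (2 : R) ≠ 0)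
    (φ : GaussianInt →+* R) {z w : GaussianInt} (hz : IsQuarticValue z) (hw : IsQuarticValue w)
    (h : φ z = φ w) : z = w := by
  by_contra hne
  have hdvd : z - w ∣ 4 := by
    have hnorm : z - w ∣ ((z - w).norm : GaussianInt) := ⟨_, Zsqrtd.norm_eq_mul_conj _⟩
    exact hnorm.trans (by
      simpa using map_dvd (Int.castRingHom GaussianInt) (hz.sub_norm_dvd_four hw hne))
  have h4 : (4 : R) = 0 := by
    simpa only [map_sub, h, sub_self, zero_dvd_iff, map_ofNat] using map_dvd φ hdvd
  exact h2 (pow_eq_zero_iff two_ne_zero |>.1 (by rw [← h4]; norm_num))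

lemma two_ne_zero_of_odd_char {R : Type*} [CommRing R] [Nontrivial R] {l : ℕ} [CharP R l]
    (hl : Odd l) : (2 : R) ≠ 0 := by
  intro h
  have hdvd : l ∣ 2 := (CharP.cast_eq_zero_iff R l 2).1 (by exact_mod_cast h)
  rcases (Nat.dvd_prime Nat.prime_two).1 hdvd with rfl | rfl
  · exact CharP.char_ne_one R 1 rfl
  · exact absurd hl (by decide)

lemma mul_star_self_of_isUnit {u : GaussianInt} (h : IsUnit u) : u * star u = 1 := by
  rw [← Zsqrtd.norm_eq_mul_conj, isUnit_iff_norm_eq_one.1 h, Int.cast_one]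

lemma prime_of_norm_eq_prime {π : GaussianInt} {p : ℕ} (hp : p.Prime) (h : π.norm = p) :
    Prime π := by
  refine Irreducible.prime ⟨fun hu => ?_, fun a b hab => ?_⟩
  · rw [isUnit_iff_norm_eq_one, h] at hu
    exact hp.ne_one (by exact_mod_cast hu)
  · rw [← Zsqrtd.norm_eq_one_iff, ← Zsqrtd.norm_eq_one_iff]
    have hmul : a.norm.natAbs * b.norm.natAbs = p := by
      rw [← Int.natAbs_mul, ← Zsqrtd.norm_mul, ← hab, h, Int.natAbs_natCast]
    rcases Nat.prime_mul_iff.1 (hmul ▸ hp) with ⟨-, h⟩ | ⟨-, h⟩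
    · exact .inr h
    · exact .inl h

lemma isCoprime_intCast_iff {m n : ℤ} :
    IsCoprime (m : GaussianInt) (n : GaussianInt) ↔ IsCoprime m n := by
  refine ⟨fun ⟨a, b, hab⟩ => ⟨a.re, b.re, ?_⟩, fun h => h.map (Int.castRingHom GaussianInt)⟩
  simpa using congrArg Zsqrtd.re hab

lemma symbolExponent_of_norm_eq {π : GaussianInt} {l : ℕ} (h : π.norm = l) :
    symbolExponent π = (l - 1) / 4 := by
  rw [symbolExponent, h, Int.natAbs_natCast]

lemma odd_norm_of_norm_eq {π : GaussianInt} {l : ℕ} (hl : l % 4 = 1) (h : π.norm = l) :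
    Odd π.norm := by
  rw [h, Int.odd_iff]
  omega

section ResidueCharacteristic

variable {F : Type*} [Field F] (φ : GaussianInt →+* F) {l : ℕ} [Fact l.Prime] [CharP F l]
  {α z w : GaussianInt}

lemma exists_prime_map_eq_zero (hl : l % 4 = 1) :
    ∃ ρ : GaussianInt, Prime ρ ∧ ρ.norm = l ∧ φ ρ = 0 := by
  obtain ⟨a, b, h⟩ := Nat.Prime.sq_add_sq (p := l) (by omega)
  have hN : (⟨a, b⟩ : GaussianInt).norm = l := by
    rw [← h, Zsqrtd.norm]
    push_cast
    ring
  have h0 : φ ⟨a, b⟩ * φ (star ⟨a, b⟩) = 0 := by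
    rw [← map_mul, ← Zsqrtd.norm_eq_mul_conj, hN, Int.cast_natCast, map_natCast,
      CharP.cast_eq_zero]
  have hN' : (star (⟨a, b⟩ : GaussianInt)).norm = l := by rw [Zsqrtd.norm_conj, hN]
  rcases mul_eq_zero.1 h0 with h0 | h0
  · exact ⟨_, prime_of_norm_eq_prime Fact.out hN, hN, h0⟩
  · exact ⟨_, prime_of_norm_eq_prime Fact.out hN', hN', h0⟩

lemma exists_isQuarticValue_map_pow (hl : l % 4 = 1) (α : GaussianInt) :
    ∃ z, IsQuarticValue z ∧ φ α ^ ((l - 1) / 4) = φ z := by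
  obtain ⟨ρ, hρ, hN, h0⟩ := exists_prime_map_eq_zero φ hl
  obtain ⟨z, hz, hd⟩ := exists_isQuarticValue_dvd_sub hρ (odd_norm_of_norm_eq hl hN) α
  refine ⟨z, hz, ?_⟩
  rwa [← map_eq_zero_iff_dvd hρ h0, map_sub, map_pow, sub_eq_zero,
    symbolExponent_of_norm_eq hN] at hd

lemma symbol_natCast_of_mod_four_eq_one (hl : l % 4 = 1) (hz : IsQuarticValue z)
    (hw : IsQuarticValue w) (hα : φ α ^ ((l - 1) / 4) = φ z)
    (hα' : φ (star α) ^ ((l - 1) / 4) = φ w) : symbol α l = toComplex (z * star w) := by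
  obtain ⟨ρ, hρ, hN, h0⟩ := exists_prime_map_eq_zero φ hl
  have ho := odd_norm_of_norm_eq hl hN
  rw [← symbolExponent_of_norm_eq hN] at hα hα'
  have hsplit : (l : GaussianInt) = ρ * star ρ := by
    rw [← Zsqrtd.norm_eq_mul_conj, hN, Int.cast_natCast]
  rw [hsplit, symbol_mul_right hρ.ne_zero (prime_star hρ).ne_zero, ← star_star α,
    symbol_star ho, star_star, symbol_of_prime hρ, symbol_of_prime hρ,
    primeSymbol_eq_of_map_pow_eq hρ ho h0 hz hα, primeSymbol_eq_of_map_pow_eq hρ ho h0 hw hα',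
    map_mul, toComplex_star]
  rfl

lemma symbol_natCast_of_mod_four_eq_three (hl : l % 4 = 3) (hz : IsQuarticValue z)
    (h0 : φ α ≠ 0) (h : φ (star α) ^ ((l + 1) / 4) = φ z * φ α ^ ((l + 1) / 4)) :
    symbol α l = toComplex z := by
  have hπ := prime_of_nat_prime_of_mod_four_eq_three l hl
  have ho : Odd (l : GaussianInt).norm := odd_norm_natCast (by rw [Nat.odd_iff]; omega)
  rw [symbol_of_prime hπ]
  refine primeSymbol_eq_of_map_pow_eq (φ := φ) hπ ho (by rw [map_natCast, CharP.cast_eq_zero]) hz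
    (mul_right_cancel₀ (pow_ne_zero ((l + 1) / 4) h0) ?_)
  have hexp : symbolExponent (l : GaussianInt) + (l + 1) / 4 = l * ((l + 1) / 4) := by
    have hN := natAbs_norm_eq ho
    rw [Zsqrtd.norm_natCast, Int.natAbs_mul, Int.natAbs_natCast] at hN
    obtain ⟨k, rfl⟩ : ∃ k, l = 4 * k + 3 := ⟨l / 4, by omega⟩
    rw [show (4 * k + 3 + 1) / 4 = k + 1 by omega]
    linarith
  rw [← pow_add, hexp, pow_mul, map_pow_char_of_mod_four_eq_three φ hl, h]

end ResidueCharacteristic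

lemma exists_hom_algebraicClosure (l : ℕ) [Fact l.Prime] :
    Nonempty (GaussianInt →+* AlgebraicClosure (ZMod l)) := by
  obtain ⟨r, hr⟩ := IsAlgClosed.exists_pow_nat_eq (-1 : AlgebraicClosure (ZMod l)) two_pos
  exact ⟨Zsqrtd.lift ⟨r, by rw [← sq, hr, Int.cast_neg, Int.cast_one]⟩⟩

lemma ne_zero_of_mod_four {n : ℤ} (h : n % 4 = 1) : (n : GaussianInt) ≠ 0 := by
  rw [Int.cast_ne_zero]
  omega

lemma odd_norm_of_mod_four {n : ℤ} (h : n % 4 = 1) : Odd (n : GaussianInt).norm :=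
  odd_norm_intCast (by rw [Int.odd_iff]; omega)

lemma induction_on_mod_four_eq_one {P : (n : ℤ) → n % 4 = 1 → Prop} (one : P 1 rfl)
    (mul : ∀ a b (ha : a % 4 = 1) (hb : b % 4 = 1), P a ha → P b hb →
      P (a * b) (by rw [Int.mul_emod, ha, hb]; rfl))
    (split : ∀ (l : ℕ) (hl : l % 4 = 1), l.Prime → P l (by omega))
    (inert : ∀ (l : ℕ) (hl : l % 4 = 3), l.Prime → P (-l) (by omega))
    {n : ℤ} (hn : n % 4 = 1) : P n hn := by
  induction h : n.natAbs using induction_on_primes generalizing n with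
  | zero => omega
  | one =>
    obtain rfl : n = 1 := by omega
    exact one
  | prime_mul l m hl ih =>
    obtain ⟨a, ha, hal, hPa⟩ : ∃ (a : ℤ) (ha : a % 4 = 1), a.natAbs = l ∧ P a ha := by
      have hodd : Odd (l * m) := by rw [← h, Nat.odd_iff]; omega
      have hl2 := Nat.odd_iff.1 (Nat.Odd.of_mul_left hodd)
      obtain hl4 | hl4 : l % 4 = 1 ∨ l % 4 = 3 := by omega
      · exact ⟨l, by omega, by omega, split l hl4 hl⟩
      · exact ⟨-l, by omega, by omega, inert l hl4 hl⟩
    obtain ⟨b, rfl⟩ : a ∣ n := Int.natAbs_dvd_natAbs.1 (hal ▸ h ▸ dvd_mul_right _ _)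
    have hb : b % 4 = 1 := by
      rw [Int.mul_emod, ha] at hn
      omega
    rw [Int.natAbs_mul, hal] at h
    exact mul a b ha hb hPa (ih hb (Nat.eq_of_mul_eq_mul_left hl.pos h))

lemma symbol_intCast_of_isCoprime_of_mod_four {m n : ℤ} (hm : m % 4 = 1) (h : IsCoprime n m) :
    symbol n m = 1 := by
  have cast_ne_zero {l : ℕ} [Fact l.Prime] (h : IsCoprime n l) :
      (n : AlgebraicClosure (ZMod l)) ≠ 0 := by
    rw [Ne, CharP.intCast_eq_zero_iff (AlgebraicClosure (ZMod l)) l]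
    exact fun hd => (Nat.prime_iff_prime_int.1 Fact.out).not_isUnit (h.isUnit_of_dvd' hd dvd_rfl)
  induction hm using induction_on_mod_four_eq_one with
  | one => exact symbol_of_isUnit (by simp) _
  | mul a b ha hb iha ihb =>
    rw [Int.cast_mul, symbol_mul_right (ne_zero_of_mod_four ha) (ne_zero_of_mod_four hb),
      iha h.of_mul_right_left, ihb h.of_mul_right_right, mul_one]
  | split l hl hlp =>
    have := Fact.mk hlp
    obtain ⟨φ⟩ := exists_hom_algebraicClosure l
    obtain ⟨z, hz, hφ⟩ := exists_isQuarticValue_map_pow φ hl n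
    have hu : IsUnit z := hz.resolve_left fun hz0 => pow_ne_zero ((l - 1) / 4)
      (cast_ne_zero h) (by rw [← map_intCast φ, hφ, hz0, map_zero])
    rw [Int.cast_natCast, symbol_natCast_of_mod_four_eq_one φ hl hz hz hφ (by rwa [star_intCast]),
      mul_star_self_of_isUnit hu, map_one]
  | inert l hl hlp =>
    have := Fact.mk hlp
    obtain ⟨φ⟩ := exists_hom_algebraicClosure l
    rw [Int.cast_neg, Int.cast_natCast, symbol_neg_right, symbol_natCast_of_mod_four_eq_three φ hl
      (.inr isUnit_one) (by rw [map_intCast]; exact cast_ne_zero (by simpa using h.neg_right))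
      (by rw [star_intCast, map_one, one_mul]), map_one]

lemma symbol_intCast_of_isCoprime {m n : ℤ} (hm : Odd m) (h : IsCoprime n m) :
    symbol n m = 1 := by
  obtain hm | hm : m % 4 = 1 ∨ -m % 4 = 1 := by
    rw [Int.odd_iff] at hm
    omega
  · exact symbol_intCast_of_isCoprime_of_mod_four hm h
  · rw [← symbol_intCast_of_isCoprime_of_mod_four hm h.neg_right, Int.cast_neg, symbol_neg_right]

lemma map_one_add_I_ne_zero {R : Type*} [CommRing R] [Nontrivial R] {l : ℕ} [CharP R l]
    (hl : Odd l) (φ : GaussianInt →+* R) : φ ⟨1, 1⟩ ≠ 0 := by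
  have h2 : φ ⟨1, 1⟩ * φ ⟨1, -1⟩ = 2 := by
    rw [← map_mul, show (⟨1, 1⟩ : GaussianInt) * ⟨1, -1⟩ = 2 by decide, map_ofNat]
  exact left_ne_zero_of_mul (h2 ▸ two_ne_zero_of_odd_char hl)

lemma symbol_one_add_I_left {n : ℤ} (hn : n % 4 = 1) :
    symbol ⟨1, 1⟩ n = Complex.I ^ ((n - 1) / 4) := by
  have hstar : star (⟨1, 1⟩ : GaussianInt) = ⟨0, -1⟩ * ⟨1, 1⟩ := by decide
  have hI : IsUnit (⟨0, -1⟩ : GaussianInt) := isUnit_iff.2 (by simp)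
  induction hn using induction_on_mod_four_eq_one with
  | one => simpa using symbol_of_isUnit isUnit_one _
  | mul a b ha hb iha ihb =>
    rw [Int.cast_mul, symbol_mul_right (ne_zero_of_mod_four ha) (ne_zero_of_mod_four hb), iha, ihb,
      ← zpow_add₀ Complex.I_ne_zero, I_zpow_eq_iff]
    obtain ⟨k, rfl⟩ : ∃ k, a = 4 * k + 1 := ⟨a / 4, by omega⟩
    obtain ⟨j, rfl⟩ : ∃ j, b = 4 * j + 1 := ⟨b / 4, by omega⟩
    rw [show (4 * k + 1) * (4 * j + 1) - 1 = 4 * (4 * (k * j) + k + j) by ring]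
    unfold Int.ModEq
    omega
  | split l hl hlp =>
    have := Fact.mk hlp
    obtain ⟨φ⟩ := exists_hom_algebraicClosure l
    obtain ⟨z, hz, hφ⟩ := exists_isQuarticValue_map_pow φ hl ⟨1, 1⟩
    have hu : IsUnit z := hz.resolve_left fun hz0 => pow_ne_zero ((l - 1) / 4)
      (map_one_add_I_ne_zero (l := l) (Nat.odd_iff.2 (by omega)) φ) (by rw [hφ, hz0, map_zero])
    rw [Int.cast_natCast, symbol_natCast_of_mod_four_eq_one φ hl hz
      (.inr ((hI.pow ((l - 1) / 4)).mul hu)) hφ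
      (by rw [hstar, map_mul, mul_pow, hφ, map_mul, map_pow]), star_mul', mul_left_comm,
      mul_star_self_of_isUnit hu, mul_one, star_pow, map_pow,
      show star (⟨0, -1⟩ : GaussianInt) = ⟨0, 1⟩ by decide, toComplex_I, ← zpow_natCast]
    congr 1
    omega
  | inert l hl hlp =>
    have := Fact.mk hlp
    obtain ⟨φ⟩ := exists_hom_algebraicClosure l
    rw [Int.cast_neg, Int.cast_natCast, symbol_neg_right,
      symbol_natCast_of_mod_four_eq_three φ hl (.inr (hI.pow ((l + 1) / 4)))
        (map_one_add_I_ne_zero (l := l) (Nat.odd_iff.2 (by omega)) φ)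
        (by rw [hstar, map_mul, mul_pow, map_pow]),
      map_pow, toComplex_neg_I, ← Complex.inv_I, inv_pow, ← zpow_natCast, ← zpow_neg]
    congr 1
    omega

end RationalInteger

section GaussSum

variable {K R : Type*} [Field K] [Fintype K] [CommRing R] {χ : MulChar K R} {ψ : AddChar K R}

lemma apply_mul_gaussSum_pow {l : ℕ} [Fact l.Prime] [CharP R l] (hl : (l : K) ≠ 0)
    (χ : MulChar K R) (ψ : AddChar K R) :
    (χ ^ l) l * gaussSum χ ψ ^ l = gaussSum (χ ^ l) ψ := by
  have h := gaussSum_mulShift (χ ^ l) ψ (Units.mk0 (l : K) hl)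
  rwa [Units.val_mk0, ← AddChar.pow_mulShift, ← gaussSum_frob] at h

variable [IsDomain R]

lemma gaussSum_pow_four (h4 : χ ^ 4 = 1) (h2 : χ * χ ≠ 1) (hψ : ψ.IsPrimitive) :
    gaussSum χ ψ ^ 4 = Fintype.card K * jacobiSum χ χ ^ 2 := by
  have hquad : (χ * χ).IsQuadratic := by
    intro a
    rcases eq_or_ne a 0 with rfl | ha
    · exact .inl (MulChar.map_zero _)
    · have hsq : (χ * χ) a * (χ * χ) a = 1 := by
        rw [← MulChar.mul_apply, ← sq, ← sq, ← pow_mul, h4,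
          MulChar.one_apply ha.isUnit]
      exact .inr (mul_self_eq_one_iff.1 hsq)
  have hsq := gaussSum_sq h2 hquad hψ
  rw [MulChar.mul_apply, ← map_mul, neg_mul_neg, one_mul, map_one, one_mul] at hsq
  calc gaussSum χ ψ ^ 4 = (gaussSum χ ψ * gaussSum χ ψ) ^ 2 := by ring
    _ = gaussSum (χ * χ) ψ ^ 2 * jacobiSum χ χ ^ 2 := by
      rw [← jacobiSum_mul_nontrivial h2 ψ, mul_pow]
    _ = _ := by rw [hsq]

lemma inv_apply_neg_mul_gaussSum_pow {l : ℕ} [Fact l.Prime] [CharP R l] (hl : (l : K) ≠ 0)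
    (hχ : χ ≠ 1) (hpow : χ ^ l = χ⁻¹) (hψ : ψ.IsPrimitive) :
    χ⁻¹ (-l) * gaussSum χ ψ ^ (l + 1) = Fintype.card K := by
  have hfrob := apply_mul_gaussSum_pow hl χ ψ
  rw [hpow, ← mul_gaussSum_inv_eq_gaussSum χ⁻¹] at hfrob
  have hneg : χ⁻¹ (-1) * χ⁻¹ (-1) = 1 := by rw [← map_mul, neg_mul_neg, one_mul, map_one]
  rw [← gaussSum_mul_gaussSum_eq_card hχ hψ, ← neg_one_mul, map_mul, pow_succ]
  linear_combination χ⁻¹ (-1) * gaussSum χ ψ * hfrob +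
    gaussSum χ ψ * gaussSum χ⁻¹ ψ⁻¹ * hneg

end GaussSum

section GaussianMulChar

lemma mulChar_pow_four {M : Type*} [CommMonoid M] (χ : MulChar M GaussianInt) : χ ^ 4 = 1 :=
  MulChar.ext fun a => by
    rw [MulChar.pow_apply_coe, pow_four_of_isUnit (a.isUnit.map χ), MulChar.one_apply_coe]

variable {K : Type*} [Field K]

lemma star_mulChar_apply (χ : MulChar K GaussianInt) (a : K) : star (χ a) = χ⁻¹ a := by
  rcases eq_or_ne a 0 with rfl | ha
  · rw [MulChar.map_zero, MulChar.map_zero, star_zero]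
  · have hu := ha.isUnit.map χ
    have hinv : χ a * χ⁻¹ a = 1 := by
      rw [← MulChar.mul_apply, mul_inv_cancel, MulChar.one_apply ha.isUnit]
    exact mul_left_cancel₀ hu.ne_zero ((mul_star_self_of_isUnit hu).trans hinv.symm)

lemma jacobiSum_mul_star_self [Fintype K] {χ : MulChar K GaussianInt} (h2 : χ * χ ≠ 1) :
    jacobiSum χ χ * star (jacobiSum χ χ) = Fintype.card K := by
  have hstar : star (jacobiSum χ χ) = jacobiSum χ⁻¹ χ⁻¹ := by
    simp only [jacobiSum, star_sum, star_mul', star_mulChar_apply]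
  have hχ : χ ≠ 1 := fun h1 => h2 (by rw [h1, mul_one])
  have hχ' := (MulChar.ringHomComp_ne_one_iff toComplex_injective).2 hχ
  have hχ2 := (MulChar.ringHomComp_ne_one_iff toComplex_injective).2 h2
  rw [MulChar.ringHomComp_mul] at hχ2
  have h := jacobiSum_mul_jacobiSum_inv (F := K) (F' := ℂ) (by
    rw [ringChar.eq_zero (R := ℂ)]
    exact (CharP.char_ne_zero_of_finite K (ringChar K)).symm) hχ' hχ' hχ2
  rw [MulChar.ringHomComp_inv, jacobiSum_ringHomComp, jacobiSum_ringHomComp, ← hstar, ← map_mul]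
    at h
  exact toComplex_injective (by rw [h, map_natCast])

end GaussianMulChar

/-- A multiplicative character `χ` modulo `p` with values in the Gaussian integers which lifts
`a ↦ a ^ ((p - 1) / 4)` through the ring homomorphism `f`: the quartic residue character at the
kernel of `f`. -/
structure IsQuarticLift {p : ℕ} (f : GaussianInt →+* ZMod p) (χ : MulChar (ZMod p) GaussianInt) :
    Prop where
  isQuarticValue : ∀ a, IsQuarticValue (χ a)
  map_apply : ∀ a, f (χ a) = a ^ ((p - 1) / 4)

section QuarticCharacter

variable {p : ℕ} [Fact p.Prime] {f : GaussianInt →+* ZMod p} {χ : MulChar (ZMod p) GaussianInt}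
  {π : GaussianInt}

lemma exists_hom_zmod (hp : p % 4 = 1) (hN : π.norm = p) :
    ∃ f : GaussianInt →+* ZMod p, f π = 0 := by
  obtain ⟨r, hr⟩ := ZMod.exists_sq_eq_neg_one_iff.2 (show p % 4 ≠ 3 by omega)
  let f : GaussianInt →+* ZMod p := Zsqrtd.lift ⟨r, by rw [← hr, Int.cast_neg, Int.cast_one]⟩
  have h0 : f π * f (star π) = 0 := by
    rw [← map_mul, ← Zsqrtd.norm_eq_mul_conj, hN, Int.cast_natCast, map_natCast,
      CharP.cast_eq_zero]
  rcases mul_eq_zero.1 h0 with h0 | h0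
  · exact ⟨f, h0⟩
  · exact ⟨f.comp (starRingEnd GaussianInt), h0⟩

lemma exists_isQuarticLift (hp : p % 4 = 1) (f : GaussianInt →+* ZMod p) :
    ∃ χ, IsQuarticLift f χ := by
  have h2 : (2 : ZMod p) ≠ 0 := two_ne_zero_of_odd_char (l := p) (Nat.odd_iff.2 (by omega))
  have hpos : (p - 1) / 4 ≠ 0 := by
    have := (Fact.out : p.Prime).two_le
    omega
  have hex (a : ZMod p) : ∃ z, IsQuarticValue z ∧ f z = a ^ ((p - 1) / 4) := by
    obtain ⟨z, hz, h⟩ := exists_isQuarticValue_map_pow f hp a.val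
    exact ⟨z, hz, by rw [← h, map_natCast, ZMod.natCast_zmod_val]⟩
  choose z hz hfz using hex
  refine ⟨{ toFun := z, map_one' := ?_, map_mul' := fun a b => ?_, map_nonunit' := fun a ha => ?_ },
    ⟨hz, hfz⟩⟩
  · exact (hz 1).eq_of_map_eq h2 f (.inr isUnit_one) (by rw [hfz, map_one, one_pow])
  · exact (hz _).eq_of_map_eq h2 f ((hz a).mul (hz b)) (by
      rw [map_mul, hfz, hfz, hfz, mul_pow])
  · rw [isUnit_iff_ne_zero, not_not] at ha
    exact (hz _).eq_of_map_eq h2 f (.inl rfl) (by rw [hfz, map_zero, ha, zero_pow hpos])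

namespace IsQuarticLift

lemma mul_self_ne_one (h : IsQuarticLift f χ) (hp : p % 4 = 1) : χ * χ ≠ 1 := by
  intro h1
  obtain ⟨a, ha⟩ := FiniteField.exists_nonsquare (F := ZMod p) (by rw [ZMod.ringChar_zmod_n]; omega)
  have ha0 : a ≠ 0 := fun h0 => ha (h0 ▸ .zero)
  refine ha ((ZMod.euler_criterion p ha0).2 ?_)
  calc a ^ (p / 2) = a ^ ((p - 1) / 4) * a ^ ((p - 1) / 4) := by
        rw [← pow_add]
        congr 1
        omega
    _ = f ((χ * χ) a) := by rw [MulChar.mul_apply, map_mul, h.map_apply]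
    _ = 1 := by rw [h1, MulChar.one_apply ha0.isUnit, map_one]

lemma map_jacobiSum (h : IsQuarticLift f χ) (hp : p % 4 = 1) : f (jacobiSum χ χ) = 0 := by
  have hp2 := (Fact.out : p.Prime).two_le
  simp only [jacobiSum, map_sum, map_mul, h.map_apply]
  simp_rw [sub_eq_neg_add, add_pow, Finset.mul_sum]
  rw [Finset.sum_comm]
  refine Finset.sum_eq_zero fun k hk => ?_
  have hk' := Finset.mem_range.1 hk
  have hs := FiniteField.sum_pow_lt_card_sub_one (ZMod p) ((p - 1) / 4 + k) (by
    rw [ZMod.card]; omega)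
  calc _ = ∑ a : ZMod p, ((-1) ^ k * (((p - 1) / 4).choose k : ZMod p)) * a ^ ((p - 1) / 4 + k) :=
        Finset.sum_congr rfl fun a _ => by rw [one_pow, neg_pow, pow_add]; ring
    _ = 0 := by rw [← Finset.mul_sum, hs, mul_zero]

lemma jacobiSum_sq (h : IsQuarticLift f χ) (hp : p % 4 = 1) (hN : π.norm = p) (h0 : f π = 0)
    (hi : Even π.im) : jacobiSum χ χ ^ 2 = π ^ 2 := by
  obtain ⟨w, hw⟩ := (map_eq_zero_iff_dvd (prime_of_norm_eq_prime Fact.out hN) h0).1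
    (h.map_jacobiSum hp)
  have hwu : IsUnit w := by
    have hJ := congrArg Zsqrtd.norm hw
    have hJN : (jacobiSum χ χ).norm = p := by
      have := jacobiSum_mul_star_self (h.mul_self_ne_one hp)
      rw [← Zsqrtd.norm_eq_mul_conj, ZMod.card] at this
      exact_mod_cast this
    rw [Zsqrtd.norm_mul, hJN, hN] at hJ
    exact isUnit_iff_norm_eq_one.2 (mul_left_cancel₀
      (Nat.cast_ne_zero.2 (Fact.out : p.Prime).ne_zero) (by rw [← hJ, mul_one]))
  -- Since `J ≡ -1` modulo `(i - 1) ^ 2 = -2 * i`, the imaginary part of `J = π * w` is even.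
  obtain ⟨z, -, hz⟩ := exists_jacobiSum_eq_neg_one_add (n := 4) (by norm_num) (mulChar_pow_four χ)
    (mulChar_pow_four χ) (by rw [ZMod.card]; omega) isPrimitiveRoot_I
  rw [show ((⟨0, 1⟩ : GaussianInt) - 1) ^ 2 = ⟨0, -2⟩ by decide, hw] at hz
  have him := congrArg Zsqrtd.im hz
  have hre : Odd π.re := by
    have := odd_norm_iff.1 (odd_norm_of_norm_eq hp hN)
    rwa [Int.odd_add, iff_true_right hi] at this
  obtain ⟨k, hk⟩ := hre
  rcases isUnit_iff.1 hwu with rfl | rfl | rfl | rfl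
  · rw [hw, mul_one]
  · rw [hw, mul_neg_one, neg_sq]
  all_goals
    simp at him
    omega

lemma symbol_intCast (h : IsQuarticLift f χ) (hp : p % 4 = 1) (hN : π.norm = p) (h0 : f π = 0)
    (n : ℤ) : symbol n π = toComplex (χ n) := by
  have hπ := prime_of_norm_eq_prime Fact.out hN
  rw [symbol_of_prime hπ]
  refine primeSymbol_eq_of_map_pow_eq hπ (odd_norm_of_norm_eq hp hN) h0 (h.isQuarticValue n) ?_
  rw [map_intCast, h.map_apply, symbolExponent_of_norm_eq hN]

section Frobenius

variable {F : Type*} [Field F] {φ : GaussianInt →+* F} {ψ : AddChar (ZMod p) F}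

lemma ringHomComp_mul_self_ne_one (h : IsQuarticLift f χ) (hp : p % 4 = 1) (h2 : (2 : F) ≠ 0)
    (φ : GaussianInt →+* F) : χ.ringHomComp φ * χ.ringHomComp φ ≠ 1 := by
  intro h1
  refine h.mul_self_ne_one hp (MulChar.ext fun a => ?_)
  rw [MulChar.one_apply_coe, MulChar.mul_apply]
  refine ((h.isQuarticValue _).mul (h.isQuarticValue _)).eq_of_map_eq h2 φ (.inr isUnit_one) ?_
  rw [map_mul, map_one, ← MulChar.one_apply_coe (R' := F) a, ← h1]
  rfl

lemma ringHomComp_ne_one (h : IsQuarticLift f χ) (hp : p % 4 = 1) (h2 : (2 : F) ≠ 0)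
    (φ : GaussianInt →+* F) : χ.ringHomComp φ ≠ 1 :=
  fun h1 => h.ringHomComp_mul_self_ne_one hp h2 φ (by rw [h1, mul_one])

lemma gaussSum_pow_four (h : IsQuarticLift f χ) (hp : p % 4 = 1) (h2 : (2 : F) ≠ 0)
    (hN : π.norm = p) (h0 : f π = 0) (hi : Even π.im) (hψ : ψ.IsPrimitive) :
    gaussSum (χ.ringHomComp φ) ψ ^ 4 = φ (π ^ 3 * star π) := by
  have h4 : χ.ringHomComp φ ^ 4 = 1 := by
    rw [MulChar.ringHomComp_pow, mulChar_pow_four, MulChar.ringHomComp_one]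
  rw [QuarticJacobi.gaussSum_pow_four h4 (h.ringHomComp_mul_self_ne_one hp h2 φ) hψ,
    jacobiSum_ringHomComp, ← map_pow, h.jacobiSum_sq hp hN h0 hi, ZMod.card, ← map_natCast φ,
    ← Int.cast_natCast, ← hN, Zsqrtd.norm_eq_mul_conj, ← map_mul]
  congr 1
  ring

end Frobenius

end IsQuarticLift

end QuarticCharacter

section Reciprocity

lemma natCast_ne_zero_of_prime_ne {R : Type*} [AddMonoidWithOne R] {p l : ℕ} [CharP R l]
    (hp : p.Prime) (hl : l.Prime) (h : p ≠ l) : (p : R) ≠ 0 := by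
  rw [Ne, CharP.cast_eq_zero_iff R l, Nat.prime_dvd_prime_iff_eq hl hp]
  exact h.symm

lemma exists_isPrimitive_addChar {p l : ℕ} [Fact p.Prime] [Fact l.Prime] (h : p ≠ l) :
    ∃ ψ : AddChar (ZMod p) (AlgebraicClosure (ZMod l)), ψ.IsPrimitive := by
  have : NeZero (p : AlgebraicClosure (ZMod l)) :=
    ⟨natCast_ne_zero_of_prime_ne Fact.out Fact.out h⟩
  obtain ⟨ζ, hζ⟩ := HasEnoughRootsOfUnity.exists_primitiveRoot (AlgebraicClosure (ZMod l)) p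
  exact ⟨_, AddChar.zmodChar_primitive_of_primitive_root p hζ⟩

lemma mulChar_pow_of_mod_four_eq_one {M : Type*} [CommMonoid M] (χ : MulChar M GaussianInt)
    {l : ℕ} (hl : l % 4 = 1) : χ ^ l = χ := by
  rw [pow_eq_pow_mod l (mulChar_pow_four χ), hl, pow_one]

lemma mulChar_pow_of_mod_four_eq_three {M : Type*} [CommMonoid M] (χ : MulChar M GaussianInt)
    {l : ℕ} (hl : l % 4 = 3) : χ ^ l = χ⁻¹ := by
  rw [pow_eq_pow_mod l (mulChar_pow_four χ), hl, eq_inv_iff_mul_eq_one, ← pow_succ,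
    mulChar_pow_four]

variable {p l : ℕ} [Fact p.Prime] [Fact l.Prime] {π : GaussianInt}

lemma map_ne_zero_of_norm_eq_prime {R : Type*} [CommRing R] [CharP R l] (φ : GaussianInt →+* R)
    (hN : π.norm = p) (hpl : p ≠ l) : φ π ≠ 0 := fun h =>
  natCast_ne_zero_of_prime_ne (R := R) Fact.out Fact.out hpl (by
    rw [← map_natCast φ, ← Int.cast_natCast, ← hN, Zsqrtd.norm_eq_mul_conj, map_mul, h, zero_mul])

section Frobenius

variable {f : GaussianInt →+* ZMod p} {χ : MulChar (ZMod p) GaussianInt}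
  {φ : GaussianInt →+* AlgebraicClosure (ZMod l)} {z w : GaussianInt}

lemma IsQuarticLift.map_mul_eq_one (h : IsQuarticLift f χ) (hp : p % 4 = 1) (hN : π.norm = p)
    (h0 : f π = 0) (hi : Even π.im) (hl : l % 4 = 1) (hpl : p ≠ l)
    (hz : φ π ^ ((l - 1) / 4) = φ z) (hw : φ (star π) ^ ((l - 1) / 4) = φ w) :
    φ (χ l * (z ^ 3 * w)) = 1 := by
  obtain ⟨ψ, hψ⟩ := exists_isPrimitive_addChar hpl
  have h2 : (2 : AlgebraicClosure (ZMod l)) ≠ 0 :=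
    two_ne_zero_of_odd_char (l := l) (Nat.odd_iff.2 (by omega))
  have hG0 : gaussSum (χ.ringHomComp φ) ψ ≠ 0 := by
    refine gaussSum_ne_zero_of_nontrivial ?_ (h.ringHomComp_ne_one hp h2 φ) hψ
    rw [ZMod.card]
    exact natCast_ne_zero_of_prime_ne Fact.out Fact.out hpl
  have hfrob := apply_mul_gaussSum_pow (l := l)
    (natCast_ne_zero_of_prime_ne Fact.out Fact.out hpl.symm) (χ.ringHomComp φ) ψ
  rw [MulChar.ringHomComp_pow, mulChar_pow_of_mod_four_eq_one χ hl,
    MulChar.ringHomComp_apply] at hfrob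
  have hpow : gaussSum (χ.ringHomComp φ) ψ ^ l =
      φ (z ^ 3 * w) * gaussSum (χ.ringHomComp φ) ψ := by
    calc _ = (gaussSum (χ.ringHomComp φ) ψ ^ 4) ^ ((l - 1) / 4) *
          gaussSum (χ.ringHomComp φ) ψ := by
          rw [← pow_mul, ← pow_succ]
          congr 1
          omega
      _ = _ := by
          rw [h.gaussSum_pow_four hp h2 hN h0 hi hψ, map_mul, map_pow, mul_pow, pow_right_comm,
            hz, hw, map_mul, map_pow]
  rw [map_mul]
  exact mul_right_cancel₀ hG0 (by rw [mul_assoc, ← hpow, hfrob, one_mul])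

lemma IsQuarticLift.map_star_pow (h : IsQuarticLift f χ) (hp : p % 4 = 1) (hN : π.norm = p)
    (h0 : f π = 0) (hi : Even π.im) (hl : l % 4 = 3) (hpl : p ≠ l) :
    φ (star π) ^ ((l + 1) / 4) = φ (χ (-l)) * φ π ^ ((l + 1) / 4) := by
  obtain ⟨ψ, hψ⟩ := exists_isPrimitive_addChar hpl
  have h2 : (2 : AlgebraicClosure (ZMod l)) ≠ 0 :=
    two_ne_zero_of_odd_char (l := l) (Nat.odd_iff.2 (by omega))
  have hl0 := natCast_ne_zero_of_prime_ne (R := ZMod p) Fact.out Fact.out hpl.symm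
  have hχl : φ (star (χ (-l))) * φ (χ (-l)) = 1 := by
    rw [← map_mul, mul_comm, mul_star_self_of_isUnit ((neg_ne_zero.2 hl0).isUnit.map χ), map_one]
  have hG4 : gaussSum (χ.ringHomComp φ) ψ ^ (l + 1) =
      (φ π ^ 3) ^ ((l + 1) / 4) * φ (star π) ^ ((l + 1) / 4) := by
    rw [← mul_pow, ← map_pow, ← map_mul, ← h.gaussSum_pow_four hp h2 hN h0 hi hψ, ← pow_mul]
    congr 1
    omega
  have hcard : (p : AlgebraicClosure (ZMod l)) =
      (φ π ^ 3) ^ ((l + 1) / 4) * φ π ^ ((l + 1) / 4) := by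
    rw [← map_natCast φ, ← Int.cast_natCast, ← hN, Zsqrtd.norm_eq_mul_conj, map_mul,
      ← map_pow_char_of_mod_four_eq_three φ hl, ← pow_succ', ← mul_pow, ← pow_succ, ← pow_mul]
    congr 1
    omega
  have hG := inv_apply_neg_mul_gaussSum_pow (l := l) (χ := χ.ringHomComp φ) hl0
    (h.ringHomComp_ne_one hp h2 φ)
    (by rw [MulChar.ringHomComp_pow, mulChar_pow_of_mod_four_eq_three χ hl,
      MulChar.ringHomComp_inv]) hψ
  rw [MulChar.ringHomComp_inv, MulChar.ringHomComp_apply, ← star_mulChar_apply, ZMod.card, hG4,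
    hcard] at hG
  refine mul_left_cancel₀ (pow_ne_zero ((l + 1) / 4)
    (pow_ne_zero 3 (map_ne_zero_of_norm_eq_prime φ hN hpl))) ?_
  linear_combination φ (χ (-l)) * hG -
    (φ π ^ 3) ^ ((l + 1) / 4) * φ (star π) ^ ((l + 1) / 4) * hχl

end Frobenius

lemma symbol_natCast_comm_of_mod_four_eq_one (hp : p % 4 = 1) (hN : π.norm = p) (hi : Even π.im)
    (hl : l % 4 = 1) (hpl : p ≠ l) : symbol l π = symbol π l := by
  obtain ⟨f, h0⟩ := exists_hom_zmod hp hN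
  obtain ⟨χ, hχ⟩ := exists_isQuarticLift hp f
  obtain ⟨φ⟩ := exists_hom_algebraicClosure l
  obtain ⟨z, hz, hφz⟩ := exists_isQuarticValue_map_pow φ hl π
  obtain ⟨w, hw, hφw⟩ := exists_isQuarticValue_map_pow φ hl (star π)
  have hone : χ l * (z ^ 3 * w) = 1 :=
    ((hχ.isQuarticValue l).mul ((hz.pow 3).mul hw)).eq_of_map_eq
      (two_ne_zero_of_odd_char (l := l) (Nat.odd_iff.2 (by omega))) φ (.inr isUnit_one)
      ((hχ.map_mul_eq_one hp hN h0 hi hl hpl hφz hφw).trans (map_one φ).symm)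
  have hzw : IsUnit (z ^ 3 * w) := .of_mul_eq_one_right _ hone
  have hz4 := pow_four_of_isUnit ((isUnit_pow_iff three_ne_zero).1 (isUnit_of_mul_isUnit_left hzw))
  have hws := mul_star_self_of_isUnit (isUnit_of_mul_isUnit_right hzw)
  have hχl : χ l = z * star w := by
    linear_combination z * star w * hone - χ l * w * star w * hz4 - χ l * hws
  rw [symbol_natCast_of_mod_four_eq_one φ hl hz hw hφz hφw, ← hχl]
  exact_mod_cast hχ.symbol_intCast hp hN h0 l

lemma symbol_neg_natCast_comm_of_mod_four_eq_three (hp : p % 4 = 1) (hN : π.norm = p)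
    (hi : Even π.im) (hl : l % 4 = 3) : symbol (-l) π = symbol π (-l) := by
  have hpl : p ≠ l := by rintro rfl; omega
  obtain ⟨f, h0⟩ := exists_hom_zmod hp hN
  obtain ⟨χ, hχ⟩ := exists_isQuarticLift hp f
  obtain ⟨φ⟩ := exists_hom_algebraicClosure l
  have hsymbol := hχ.symbol_intCast hp hN h0 (-l)
  rw [Int.cast_neg, Int.cast_neg, Int.cast_natCast, Int.cast_natCast] at hsymbol
  rw [hsymbol, symbol_neg_right, symbol_natCast_of_mod_four_eq_three φ hl (hχ.isQuarticValue _)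
    (map_ne_zero_of_norm_eq_prime φ hN hpl) (hχ.map_star_pow hp hN h0 hi hl hpl)]

lemma symbol_intCast_comm_of_norm_eq_prime (hp : p % 4 = 1) (hN : π.norm = p) (hi : Even π.im)
    {n : ℤ} (hn : n % 4 = 1) : symbol n π = symbol π n := by
  have ho := odd_norm_of_norm_eq hp hN
  induction hn using induction_on_mod_four_eq_one with
  | one => rw [Int.cast_one, symbol_one_left ho, symbol_of_isUnit isUnit_one]
  | mul a b ha hb iha ihb =>
    rw [Int.cast_mul, symbol_mul_left ho, iha, ihb,
      symbol_mul_right (ne_zero_of_mod_four ha) (ne_zero_of_mod_four hb)]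
  | split l hl hlp =>
    have := Fact.mk hlp
    rw [Int.cast_natCast]
    rcases eq_or_ne p l with rfl | hpl
    · have hd : π ∣ p := ⟨star π, by rw [← Zsqrtd.norm_eq_mul_conj, hN, Int.cast_natCast]⟩
      have hnc : ¬ IsCoprime (p : GaussianInt) π := fun hc =>
        (prime_of_norm_eq_prime hlp hN).not_isUnit (hc.isUnit_of_dvd' hd dvd_rfl)
      rw [symbol_eq_zero ho hnc, symbol_eq_zero (odd_norm_natCast (Nat.odd_iff.2 (by omega)))
        (mt IsCoprime.symm hnc)]
    · exact symbol_natCast_comm_of_mod_four_eq_one hp hN hi hl hpl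
  | inert l hl hlp =>
    have := Fact.mk hlp
    rw [Int.cast_neg, Int.cast_natCast]
    exact symbol_neg_natCast_comm_of_mod_four_eq_three hp hN hi hl

lemma symbol_intCast_comm {m n : ℤ} (hm : Odd m) (hn : Odd n) : symbol m n = symbol n m := by
  by_cases h : IsCoprime m n
  · rw [symbol_intCast_of_isCoprime hn h, symbol_intCast_of_isCoprime hm h.symm]
  · rw [← isCoprime_intCast_iff] at h
    rw [symbol_eq_zero (odd_norm_intCast hn) h,
      symbol_eq_zero (odd_norm_intCast hm) (mt IsCoprime.symm h)]

end Reciprocity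

section RationalModulus

variable {n : ℤ} {γ : GaussianInt}

lemma I_zpow_mul_eq_of_modEq {a b : ℤ} (hn : n % 4 = 1) (h : a ≡ b [ZMOD 2]) :
    Complex.I ^ ((n - 1) / 2 * a) = Complex.I ^ ((n - 1) / 2 * b) := by
  obtain ⟨m, hm⟩ : ∃ m, (n - 1) / 2 = 2 * m := ⟨(n - 1) / 4, by omega⟩
  rw [I_zpow_eq_iff, hm, mul_assoc, mul_assoc]
  exact (h.mul_left m).mul_left' (c := 2)

lemma I_zpow_mul_eq_one_of_even {a : ℤ} (hn : n % 4 = 1) (ha : Even a) :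
    Complex.I ^ ((n - 1) / 2 * a) = 1 := by
  rw [I_zpow_mul_eq_of_modEq hn (Int.modEq_zero_iff_dvd.2 ha.two_dvd), mul_zero, zpow_zero]

lemma symbol_neg_one_intCast (hn : Odd n) : symbol (-1) n = 1 := by
  have h := symbol_intCast_of_isCoprime hn (n := -1) isCoprime_one_left.neg_left
  rwa [Int.cast_neg, Int.cast_one] at h

lemma symbol_I_intCast (hn : n % 4 = 1) : symbol ⟨0, 1⟩ n = Complex.I ^ ((n - 1) / 2) := by
  obtain ⟨m, rfl⟩ : ∃ m, n = 4 * m + 1 := ⟨n / 4, by omega⟩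
  have ho := odd_norm_of_mod_four hn
  have hN := norm_eq ho
  rw [Zsqrtd.norm_intCast] at hN
  rw [symbol_I_left ho, ← zpow_natCast, I_zpow_eq_iff, Int.modEq_iff_dvd,
    show (4 * m + 1 - 1) / 2 = 2 * m by omega]
  exact ⟨-m ^ 2, by linarith⟩

lemma symbol_intCast_of_isUnit {u : GaussianInt} (hu : IsUnit u) (hn : n % 4 = 1) :
    symbol u n = Complex.I ^ ((n - 1) / 2 * u.im) := by
  have ho := odd_norm_of_mod_four hn
  have hneg := symbol_neg_one_intCast (n := n) (by rw [Int.odd_iff]; omega)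
  rcases isUnit_iff.1 hu with rfl | rfl | rfl | rfl
  · simp [symbol_one_left ho]
  · simp [hneg]
  · rw [mul_one, symbol_I_intCast hn]
  · calc symbol ⟨0, -1⟩ n = symbol (-1 * ⟨0, 1⟩) n := rfl
      _ = Complex.I ^ ((n - 1) / 2 * 1) := by
        rw [symbol_mul_left ho, hneg, one_mul, symbol_I_intCast hn, mul_one]
      _ = Complex.I ^ ((n - 1) / 2 * -1) := I_zpow_mul_eq_of_modEq hn (by decide)

lemma symbol_intCast_of_norm_eq_prime {p : ℕ} [Fact p.Prime] (hp : p % 4 = 1) (hN : γ.norm = p)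
    (hn : n % 4 = 1) : symbol γ n = Complex.I ^ ((n - 1) / 2 * γ.im) * symbol n γ := by
  have ho := odd_norm_iff.1 (odd_norm_of_norm_eq hp hN)
  rcases Int.even_or_odd γ.im with hi | hi
  · rw [symbol_intCast_comm_of_norm_eq_prime hp hN hi hn,
      I_zpow_mul_eq_one_of_even hn hi, one_mul]
  · have hu : IsUnit (⟨0, 1⟩ : GaussianInt) := isUnit_iff.2 (by simp)
    have him : Even (⟨0, 1⟩ * γ).im := by
      rw [Zsqrtd.im_mul, zero_mul, zero_add, one_mul]
      rwa [add_comm, Int.odd_add, iff_true_left hi] at ho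
    have h := symbol_intCast_comm_of_norm_eq_prime hp
      (by rw [Zsqrtd.norm_mul, isUnit_iff_norm_eq_one.1 hu, one_mul, hN]) him hn
    rw [symbol_mul_left (odd_norm_of_mod_four hn), symbol_intCast_of_isUnit hu hn,
      ← symbol_of_associated (associated_unit_mul_right γ _ hu)] at h
    rw [h, ← mul_assoc, ← zpow_add₀ Complex.I_ne_zero, ← mul_add,
      I_zpow_mul_eq_one_of_even hn (hi.add_odd odd_one), one_mul]

lemma symbol_intCast_eq_mul (hn : n % 4 = 1) (hγ : Odd γ.norm) :
    symbol γ n = Complex.I ^ ((n - 1) / 2 * γ.im) * symbol n γ := by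
  have ho := odd_norm_of_mod_four hn
  induction hγ using induction_on_odd_norm with
  | unit u hu => rw [symbol_of_isUnit hu, mul_one, symbol_intCast_of_isUnit hu hn]
  | mul γ δ hγ hδ ihγ ihδ =>
    have him : (γ * δ).im ≡ γ.im + δ.im [ZMOD 2] := by
      obtain ⟨a, ha⟩ := odd_norm_iff.1 hγ
      obtain ⟨b, hb⟩ := odd_norm_iff.1 hδ
      rw [Zsqrtd.im_mul, Int.modEq_iff_dvd, eq_sub_of_add_eq ha, eq_sub_of_add_eq hb]
      exact ⟨γ.im * δ.im - a * δ.im - b * γ.im, by ring⟩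
    rw [symbol_mul_left ho, ihγ, ihδ, I_zpow_mul_eq_of_modEq hn him, mul_add,
      zpow_add₀ Complex.I_ne_zero, symbol_mul_right (ne_zero_of_odd_norm hγ)
      (ne_zero_of_odd_norm hδ), mul_mul_mul_comm]
  | prime π ho' hπ =>
    obtain ⟨p, -, h3, hass⟩ | ⟨p, hp, h1, hN⟩ := inert_or_split_of_prime hπ ho'
    · have hp2 : Odd (p : ℤ) := by rw [Int.odd_iff]; omega
      obtain ⟨u, rfl⟩ := hass.symm
      have him : ((p : GaussianInt) * u).im ≡ (u : GaussianInt).im [ZMOD 2] := by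
        obtain ⟨a, ha⟩ := hp2
        rw [← Int.cast_natCast, ha, Int.modEq_iff_dvd]
        exact ⟨-a * (u : GaussianInt).im, by simp; ring⟩
      rw [← symbol_of_associated hass.symm, symbol_mul_left ho,
        symbol_intCast_of_isUnit u.isUnit hn, I_zpow_mul_eq_of_modEq hn him, ← Int.cast_natCast,
        symbol_intCast_comm hp2 (by rw [Int.odd_iff]; omega), mul_comm]
    · have : Fact p.Prime := ⟨hp⟩
      exact symbol_intCast_of_norm_eq_prime h1 hN hn

lemma symbol_intCast_eq (hn : n % 4 = 1) (hγ : Odd γ.norm) (hi : Even γ.im) :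
    symbol γ n = symbol n γ := by
  rw [symbol_intCast_eq_mul hn hγ, I_zpow_mul_eq_one_of_even hn hi, one_mul]

end RationalModulus

section SumOfSquares

variable {c d : ℤ}

lemma norm_mk (a b : ℤ) : (⟨a, b⟩ : GaussianInt).norm = a ^ 2 + b ^ 2 := by
  rw [Zsqrtd.norm]
  ring

lemma star_I_zpow (k : ℤ) : star (Complex.I ^ k) = Complex.I ^ (-k) := by
  rw [star_zpow₀, Complex.star_def, Complex.conj_I, ← Complex.inv_I, inv_zpow']

lemma odd_norm_mk (hc : c % 4 = 1) (hd : Even d) : Odd (⟨c, d⟩ : GaussianInt).norm :=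
  odd_norm_iff.2 (Odd.add_even (Int.odd_iff.2 (show c % 2 = 1 by omega)) hd)

lemma symbol_re_mk (hc : c % 4 = 1) (hd : Even d) (h : IsCoprime c d) :
    symbol c ⟨c, d⟩ = Complex.I ^ ((c - 1) / 2) := by
  have ho := odd_norm_of_mod_four hc
  have hcongr : (c : GaussianInt) ∣ ⟨c, d⟩ - (d : GaussianInt) * ⟨0, 1⟩ :=
    ⟨1, by ext <;> simp⟩
  rw [← symbol_intCast_eq hc (odd_norm_mk hc hd) hd, symbol_congr ho hcongr, symbol_mul_left ho,
    symbol_intCast_of_isCoprime (Int.odd_iff.2 (by omega)) h.symm, one_mul, symbol_I_intCast hc]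

lemma symbol_re_add_im_mk (hc : c % 4 = 1) (hd : 4 ∣ d) (h : IsCoprime c d) :
    symbol (c + d : ℤ) ⟨c, d⟩ = Complex.I ^ (-((c + d - 1) / 4)) := by
  have hcd : (c + d) % 4 = 1 := by omega
  have hd2 : Even d := even_iff_two_dvd.2 (dvd_trans (by norm_num) hd)
  have ho := odd_norm_of_mod_four hcd
  have hcop : IsCoprime c (c + d) := by
    simpa [add_comm] using h.add_mul_left_right 1
  have hcongr : ((c + d : ℤ) : GaussianInt) ∣ ⟨c, d⟩ - (c : GaussianInt) * star ⟨1, 1⟩ :=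
    ⟨⟨0, 1⟩, by ext <;> simp; ring⟩
  have hstar := symbol_star ho ⟨1, 1⟩
  rw [star_intCast, symbol_one_add_I_left hcd, star_I_zpow] at hstar
  rw [← symbol_intCast_eq hcd (odd_norm_mk hc hd2) hd2, symbol_congr ho hcongr, symbol_mul_left ho,
    symbol_intCast_of_isCoprime (Int.odd_iff.2 (by omega)) hcop, one_mul, hstar]

lemma symbol_I_mk (hc : c % 4 = 1) (hd : 4 ∣ d) :
    symbol ⟨0, 1⟩ ⟨c, d⟩ = Complex.I ^ ((c - 1) / 2) := by
  obtain ⟨m, rfl⟩ : ∃ m, c = 4 * m + 1 := ⟨c / 4, by omega⟩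
  obtain ⟨δ, rfl⟩ := hd
  have ho : Odd (⟨4 * m + 1, 4 * δ⟩ : GaussianInt).norm := odd_norm_mk hc ⟨2 * δ, by ring⟩
  have hN := norm_eq ho
  rw [norm_mk] at hN
  rw [symbol_I_left ho, ← zpow_natCast, I_zpow_eq_iff, Int.modEq_iff_dvd,
    show (4 * m + 1 - 1) / 2 = 2 * m by omega]
  exact ⟨-m ^ 2 - δ ^ 2, by linarith⟩

lemma symbol_neg_one_mk (hc : c % 4 = 1) (hd : 4 ∣ d) : symbol (-1) ⟨c, d⟩ = 1 := by
  have ho := odd_norm_mk hc (even_iff_two_dvd.2 (dvd_trans (by norm_num) hd))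
  rw [show (-1 : GaussianInt) = ⟨0, 1⟩ * ⟨0, 1⟩ by decide, symbol_mul_left ho, symbol_I_mk hc hd,
    ← zpow_add₀ Complex.I_ne_zero, ← zpow_zero Complex.I, I_zpow_eq_iff, Int.modEq_iff_dvd]
  omega

lemma mul_I_zpow_eq_iff {z w : ℂ} {a : ℤ} :
    z * Complex.I ^ a = w ↔ z = w * Complex.I ^ (-a) := by
  rw [zpow_neg, eq_mul_inv_iff_mul_eq₀ (zpow_ne_zero a Complex.I_ne_zero)]

lemma symbol_two_mk (hc : c % 4 = 1) (hd : 4 ∣ d) (h : IsCoprime c d) :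
    symbol 2 ⟨c, d⟩ = Complex.I ^ (d / 2) := by
  have hd2 : Even d := even_iff_two_dvd.2 (dvd_trans (by norm_num) hd)
  have ho := odd_norm_mk hc hd2
  have hcongr : (⟨c, d⟩ : GaussianInt) ∣ 2 * (c : GaussianInt) ^ 2 * ⟨0, 1⟩ - (c + d : ℤ) ^ 2 :=
    ⟨⟨-c, 2 * c + d⟩, by ext <;> simp [sq] <;> ring⟩
  have hs := symbol_congr ho hcongr
  rw [symbol_mul_left ho, symbol_mul_left ho, symbol_pow_left ho, symbol_pow_left ho,
    symbol_re_mk hc hd2 h, symbol_re_add_im_mk hc hd h, symbol_I_mk hc hd, ← zpow_natCast,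
    ← zpow_natCast, ← zpow_mul, ← zpow_mul, mul_assoc, ← zpow_add₀ Complex.I_ne_zero,
    mul_I_zpow_eq_iff, ← zpow_add₀ Complex.I_ne_zero] at hs
  rw [hs, I_zpow_eq_iff, Int.modEq_iff_dvd]
  omega

end SumOfSquares

section DivOneAddI

/-- The quotient of `c + b i` by `1 + i`, for integers `c` and `b` of the same parity. -/
def divOneAddI (c b : ℤ) : GaussianInt := ⟨(c + b) / 2, (b - c) / 2⟩

variable {c b n : ℤ}

lemma mk_eq_one_add_I_mul (h : c ≡ b [ZMOD 2]) : ⟨c, b⟩ = ⟨1, 1⟩ * divOneAddI c b := by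
  obtain ⟨k, hk⟩ := h.dvd
  obtain rfl : b = c + 2 * k := by omega
  ext <;> simp [divOneAddI] <;> omega

lemma two_mul_norm_divOneAddI (h : c ≡ b [ZMOD 2]) :
    2 * (divOneAddI c b).norm = c ^ 2 + b ^ 2 := by
  rw [← norm_mk, mk_eq_one_add_I_mul h, Zsqrtd.norm_mul]
  rfl

lemma odd_norm_divOneAddI (hc : c % 4 = 1) (hb : b % 4 = 1) : Odd (divOneAddI c b).norm := by
  rw [odd_norm_iff, Int.odd_iff]
  simp only [divOneAddI]
  omega

lemma symbol_mk_intCast (hc : c % 4 = 1) (hb : b % 4 = 1) (hn : n % 4 = 1) :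
    symbol ⟨c, b⟩ n = Complex.I ^ ((n - 1) / 4) * symbol n (divOneAddI c b) := by
  have hi : Even (divOneAddI c b).im := Int.even_iff.2 (by simp only [divOneAddI]; omega)
  rw [mk_eq_one_add_I_mul (show c % 2 = b % 2 by omega), symbol_mul_left (odd_norm_of_mod_four hn),
    symbol_one_add_I_left hn, symbol_intCast_eq hn (odd_norm_divOneAddI hc hb) hi]

end DivOneAddI

/-- The situation of the theorem, normalised by `x ≡ 1 (mod 4)`: an integer `c² + d² = x² + 2qy²`,
where `c + d i` is primary and `c` is coprime to `x + d`. -/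
structure PrimaryRepresentation (q c d x y : ℤ) : Prop where
  c_mod_four : c % 4 = 1
  x_mod_four : x % 4 = 1
  four_dvd : 4 ∣ d
  even : Even y
  eq : c ^ 2 + d ^ 2 = x ^ 2 + 2 * q * y ^ 2
  isCoprime : IsCoprime c (x + d)

namespace PrimaryRepresentation

variable {q c d x y : ℤ} (h : PrimaryRepresentation q c d x y)
include h

lemma add_mod_four : (x + d) % 4 = 1 := by
  have := h.x_mod_four
  have := h.four_dvd
  omega

lemma even_d : Even d := even_iff_two_dvd.2 (dvd_trans (by norm_num) h.four_dvd)

lemma odd_norm : Odd (⟨c, d⟩ : GaussianInt).norm := odd_norm_mk h.c_mod_four h.even_d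

lemma odd_norm_divOneAddI : Odd (divOneAddI c (x + d)).norm :=
  QuarticJacobi.odd_norm_divOneAddI h.c_mod_four h.add_mod_four

lemma norm_divOneAddI : (divOneAddI c (x + d)).norm = x * (x + d) + q * y ^ 2 := by
  have hmod : c ≡ x + d [ZMOD 2] := by
    have := h.c_mod_four
    have := h.add_mod_four
    change c % 2 = (x + d) % 2
    omega
  have := two_mul_norm_divOneAddI hmod
  linarith [h.eq]

lemma symbol_neg_one (hq : Odd q) :
    symbol (-1) (divOneAddI c (x + d)) = Complex.I ^ (d / 2 + y) := by
  have hN := norm_eq h.odd_norm_divOneAddI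
  rw [h.norm_divOneAddI] at hN
  obtain ⟨w, rfl⟩ : ∃ w, x = 4 * w + 1 := ⟨x / 4, by have := h.x_mod_four; omega⟩
  obtain ⟨δ, rfl⟩ := h.four_dvd
  obtain ⟨η, rfl⟩ := h.even
  obtain ⟨j, rfl⟩ := hq
  obtain ⟨a, ha⟩ := Int.even_mul_succ_self η
  rw [symbol_neg_one_left h.odd_norm_divOneAddI, ← Complex.I_sq, ← pow_mul, ← zpow_natCast,
    I_zpow_eq_iff, Int.modEq_iff_dvd, show 4 * δ / 2 = 2 * δ by omega]
  exact ⟨η - a - j * η ^ 2 - 2 * w ^ 2 - w - 2 * w * δ, by push_cast; linarith⟩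

lemma isCoprime_add_right : IsCoprime (x + d) y := by
  have h1 : IsCoprime (x + d) (2 * q * y * y + (x + d) * (x - d)) := by
    rw [show 2 * q * y * y + (x + d) * (x - d) = c ^ 2 by linear_combination -h.eq]
    exact h.isCoprime.symm.pow_right
  exact h1.of_add_mul_left_right.of_mul_right_right

lemma symbol_sq_of_dvd {z : ℤ} (hz : z % 4 = 1) (hzy : z ∣ y) :
    symbol z (divOneAddI c (x + d)) ^ 2 = symbol z ⟨c, d⟩ := by
  have ho := odd_norm_of_mod_four hz
  have hodd : Odd z := Int.odd_iff.2 (by omega)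
  -- `γ² - 2i(x + d)π = 2qy²` for `γ = c + (x + d)i` and `π = c + di`
  have hcongr : (z : GaussianInt) ∣
      ⟨c, x + d⟩ ^ 2 - (2 * (x + d) : ℤ) * ⟨0, 1⟩ * ⟨c, d⟩ := by
    obtain ⟨k, rfl⟩ := hzy
    refine ⟨(2 * q * z * k ^ 2 : ℤ), ?_⟩
    ext
    · simp [sq]
      linear_combination h.eq
    · simp [sq]
      ring
  have hcop : IsCoprime (2 * (x + d)) z := by
    have hcop2 : IsCoprime 2 z := ⟨-((z - 1) / 2), 1, by omega⟩
    exact hcop2.mul_left (h.isCoprime_add_right.of_isCoprime_of_dvd_right hzy)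
  have hs := symbol_congr ho hcongr
  rw [symbol_pow_left ho, symbol_mk_intCast h.c_mod_four h.add_mod_four hz, symbol_mul_left ho,
    symbol_mul_left ho, symbol_intCast_of_isCoprime hodd hcop, one_mul, symbol_I_intCast hz,
    symbol_intCast_eq hz h.odd_norm h.even_d, mul_pow, ← zpow_natCast, ← zpow_mul,
    show (z - 1) / 4 * (2 : ℕ) = (z - 1) / 2 by omega] at hs
  exact mul_left_cancel₀ (zpow_ne_zero _ Complex.I_ne_zero) hs

omit h in
lemma exists_eq_two_pow_mul (hy : y ≠ 0) :
    ∃ (s : ℕ) (z : ℤ), z % 4 = 1 ∧ (y = 2 ^ s * z ∨ y = -(2 ^ s * z)) := by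
  have hfin : FiniteMultiplicity 2 y := Int.finiteMultiplicity_iff.2 ⟨by decide, hy⟩
  obtain ⟨u, hu, h2⟩ := hfin.exists_eq_pow_mul_and_not_dvd
  rcases (by omega : u % 4 = 1 ∨ -u % 4 = 1) with hmod | hmod
  · exact ⟨_, u, hmod, .inl hu⟩
  · exact ⟨_, -u, hmod, .inr (by rw [mul_neg, neg_neg]; exact hu)⟩

lemma symbol_two_pow_mul_sq (hq : Odd q) (hcd : IsCoprime c d) {s : ℕ} {z : ℤ} (hz : z % 4 = 1)
    (hzy : z ∣ y) : symbol (2 ^ s * z : ℤ) (divOneAddI c (x + d)) ^ 2 =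
      Complex.I ^ (y * s) * symbol (2 ^ s * z : ℤ) ⟨c, d⟩ := by
  have hg := h.odd_norm_divOneAddI
  have hsym (γ : GaussianInt) (hγ : Odd γ.norm) :
      symbol (2 ^ s * z : ℤ) γ = symbol 2 γ ^ s * symbol z γ := by
    rw [← symbol_pow_left hγ, ← symbol_mul_left hγ]
    push_cast
    rfl
  rw [hsym _ hg, hsym _ h.odd_norm, mul_pow, h.symbol_sq_of_dvd hz hzy, ← pow_mul, mul_comm s,
    pow_mul, symbol_two_sq hg, h.symbol_neg_one hq, symbol_two_mk h.c_mod_four h.four_dvd hcd,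
    ← mul_assoc, zpow_mul, zpow_natCast, ← mul_pow, ← zpow_add₀ Complex.I_ne_zero, add_comm y]

lemma symbol_y_sq (hq : Odd q) (hcd : IsCoprime c d) (hy : y ≠ 0) :
    symbol y (divOneAddI c (x + d)) ^ 2 = Complex.I ^ y * symbol y ⟨c, d⟩ := by
  obtain ⟨s, z, hz, hyz⟩ := exists_eq_two_pow_mul hy
  have hs : Complex.I ^ (y * s) = Complex.I ^ y := by
    rw [I_zpow_eq_iff, Int.modEq_iff_dvd]
    have hy2 := Int.even_iff.1 h.even
    rcases s with _ | _ | s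
    · omega
    · simp
    · have h4 : 4 ∣ y := by
        rcases hyz with rfl | rfl
        · exact ⟨2 ^ s * z, by ring⟩
        · exact ⟨-(2 ^ s * z), by ring⟩
      exact dvd_sub h4 (h4.mul_right _)
  have key := h.symbol_two_pow_mul_sq hq hcd (s := s) hz
    (by rcases hyz with hyz | hyz <;> simp [hyz])
  rw [hs] at key
  rcases hyz with hyz | hyz
  · rwa [← hyz] at key
  · have hg := h.odd_norm_divOneAddI
    rwa [← neg_eq_iff_eq_neg.2 hyz, Int.cast_neg, neg_eq_neg_one_mul, symbol_mul_left hg,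
      symbol_mul_left h.odd_norm, symbol_neg_one_mk h.c_mod_four h.four_dvd, one_mul, mul_pow,
      sq (symbol (-1) _), symbol_neg_one_mul_self hg, one_mul] at key

lemma symbol_x (hq : Odd q) (hcd : IsCoprime c d) (hy : y ≠ 0) :
    symbol x ⟨c, d⟩ = Complex.I ^ ((x - 1) / 2 + d / 4 + y) *
      symbol (-q : ℤ) (divOneAddI c (x + d)) * symbol y ⟨c, d⟩ := by
  have hg := h.odd_norm_divOneAddI
  have hx := odd_norm_of_mod_four h.x_mod_four
  have hb := odd_norm_of_mod_four h.add_mod_four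
  have symbol_x_mk : symbol x ⟨c, d⟩ =
      Complex.I ^ ((x - 1) / 4) * symbol x (divOneAddI c (x + d)) := by
    rw [← symbol_intCast_eq h.x_mod_four h.odd_norm h.even_d,
      ← symbol_mk_intCast h.c_mod_four h.add_mod_four h.x_mod_four]
    exact symbol_congr hx ⟨⟨0, -1⟩, by ext <;> simp⟩
  have symbol_add : Complex.I ^ ((x + d - 1) / 4) * symbol (x + d : ℤ) (divOneAddI c (x + d)) =
      1 := by
    rw [← symbol_mk_intCast h.c_mod_four h.add_mod_four h.add_mod_four,
      ← symbol_intCast_of_isCoprime (Int.odd_iff.2 (by have := h.add_mod_four; omega)) h.isCoprime]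
    exact symbol_congr hb ⟨⟨0, 1⟩, by ext <;> simp⟩
  have symbol_norm : symbol (-q : ℤ) (divOneAddI c (x + d)) * symbol y (divOneAddI c (x + d)) ^ 2 =
      symbol x (divOneAddI c (x + d)) * symbol (x + d : ℤ) (divOneAddI c (x + d)) := by
    rw [← symbol_pow_left hg, ← symbol_mul_left hg, ← symbol_mul_left hg]
    refine symbol_congr hg ⟨-star (divOneAddI c (x + d)), ?_⟩
    rw [mul_neg, ← Zsqrtd.norm_eq_mul_conj, h.norm_divOneAddI]
    push_cast
    ring
  have he : (x - 1) / 2 + d / 4 = (x - 1) / 4 + (x + d - 1) / 4 := by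
    have := h.x_mod_four
    have := h.four_dvd
    omega
  rw [h.symbol_y_sq hq hcd hy] at symbol_norm
  rw [symbol_x_mk, he, zpow_add₀ Complex.I_ne_zero, zpow_add₀ Complex.I_ne_zero]
  linear_combination -Complex.I ^ ((x - 1) / 4) * symbol x (divOneAddI c (x + d)) * symbol_add +
    -Complex.I ^ ((x - 1) / 4) * Complex.I ^ ((x + d - 1) / 4) * symbol_norm

end PrimaryRepresentation

section Transfer

lemma zpow_eq_zpow_of_sq_eq_neg_one {K : Type*} [Field K] {ι : K} (h : ι ^ 2 = -1) {a b : ℤ}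
    (hab : a ≡ b [ZMOD 4]) : ι ^ a = ι ^ b := by
  have h0 : ι ≠ 0 := by
    rintro rfl
    norm_num at h
  have h4 : ι ^ (4 : ℤ) = 1 := by
    rw [zpow_ofNat]
    linear_combination (ι ^ 2 - 1) * h
  obtain ⟨r, hr⟩ := hab.dvd
  rw [eq_add_of_sub_eq hr, zpow_add₀ h0, zpow_mul, h4, one_zpow, one_mul]

lemma neg_one_zpow_mul_zpow {K : Type*} [Field K] {ι : K} (h : ι ^ 2 = -1) {a b e : ℤ}
    (he : e ≡ 2 * a + b [ZMOD 4]) : ι ^ e = (-1) ^ a * ι ^ b := by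
  have h0 : ι ≠ 0 := by
    rintro rfl
    norm_num at h
  rw [zpow_eq_zpow_of_sq_eq_neg_one h he, zpow_add₀ h0, zpow_mul, zpow_ofNat, h]

lemma isCoprime_of_prime_eq {p : ℕ} (hp : p.Prime) {a b e : ℤ} (h : (p : ℤ) = a ^ 2 + e * b ^ 2) :
    IsCoprime a b := by
  have hsq := (Nat.prime_iff_prime_int.1 hp).squarefree
  refine isCoprime_of_prime_dvd ?_ ?_
  · rintro ⟨rfl, rfl⟩
    have := hp.ne_zero
    simp at h
    omega
  · rintro l hl ⟨u, rfl⟩ ⟨v, rfl⟩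
    exact hl.not_isUnit (hsq l ⟨u ^ 2 + e * v ^ 2, by rw [h]; ring⟩)

lemma intCast_ne_zero_of_prime_eq {p : ℕ} [Fact p.Prime] {a b e : ℤ}
    (h : (p : ℤ) = a ^ 2 + e * b ^ 2) : (b : ZMod p) ≠ 0 := fun hb => by
  have hprime := Nat.prime_iff_prime_int.1 (Fact.out : p.Prime)
  rw [ZMod.intCast_zmod_eq_zero_iff_dvd] at hb
  have ha : (p : ℤ) ∣ a ^ 2 := by
    rw [← dvd_add_left (hb.pow two_ne_zero |>.mul_left e), ← h]
  exact hprime.not_isUnit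
    ((isCoprime_of_prime_eq Fact.out h).isUnit_of_dvd' (hprime.dvd_of_dvd_pow ha) hb)

lemma map_I_sq {R : Type*} [CommRing R] (f : GaussianInt →+* R) : f ⟨0, 1⟩ ^ 2 = -1 := by
  rw [← map_pow, show (⟨0, 1⟩ : GaussianInt) ^ 2 = -1 by decide, map_neg, map_one]

variable {p : ℕ} [Fact p.Prime] {f : GaussianInt →+* ZMod p} {c d : ℤ}

lemma map_I_ne_zero : f ⟨0, 1⟩ ≠ 0 := fun h0 => by
  have h := map_I_sq f
  rw [h0] at h
  norm_num at h

lemma intCast_pow_eq_of_symbol_eq {π : GaussianInt} (hp : p % 4 = 1) (hN : π.norm = p)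
    (h0 : f π = 0) {a b e : ℤ} (h : symbol a π = Complex.I ^ e * symbol b π) :
    (a : ZMod p) ^ ((p - 1) / 4) = f ⟨0, 1⟩ ^ e * (b : ZMod p) ^ ((p - 1) / 4) := by
  obtain ⟨χ, hχ⟩ := exists_isQuarticLift hp f
  obtain ⟨n, hn⟩ : ∃ n : ℕ, e ≡ n [ZMOD 4] :=
    ⟨(e % 4).toNat, by rw [Int.toNat_of_nonneg (by omega)]; exact (Int.mod_modEq e 4).symm⟩
  have hχab : χ a = ⟨0, 1⟩ ^ n * χ b := by
    apply toComplex_injective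
    rw [← hχ.symbol_intCast hp hN h0, h, hχ.symbol_intCast hp hN h0, map_mul, map_pow, toComplex_I,
      I_zpow_eq_iff.2 hn, zpow_natCast]
  rw [← hχ.map_apply, ← hχ.map_apply, hχab, map_mul, map_pow,
    zpow_eq_zpow_of_sq_eq_neg_one (map_I_sq f) hn, zpow_natCast]

lemma intCast_eq_map_I_mul (h0 : f ⟨c, d⟩ = 0) : (d : ZMod p) = f ⟨0, 1⟩ * c := by
  have h1 : (⟨c, d⟩ : GaussianInt) * ⟨0, -1⟩ = d - ⟨0, 1⟩ * c := by ext <;> simp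
  have h2 := congrArg f h1
  rw [map_mul, h0, zero_mul, map_sub, map_mul, map_intCast, map_intCast] at h2
  exact sub_eq_zero.1 h2.symm

lemma exists_hom_zmod_map_I_eq_div (hp : p % 4 = 1) (hcd : (p : ℤ) = c ^ 2 + d ^ 2) :
    ∃ f : GaussianInt →+* ZMod p, f ⟨c, d⟩ = 0 ∧ f ⟨0, 1⟩ = d / c := by
  obtain ⟨f, h0⟩ := exists_hom_zmod hp ((norm_mk c d).trans hcd.symm)
  have hd := intCast_eq_map_I_mul h0
  have hc : (c : ZMod p) ≠ 0 := fun hc => by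
    rw [hc, mul_zero] at hd
    rw [ZMod.intCast_zmod_eq_zero_iff_dvd] at hc hd
    have hcop : IsCoprime c d := isCoprime_of_prime_eq Fact.out (by rw [hcd, one_mul])
    exact (Nat.prime_iff_prime_int.1 (Fact.out : p.Prime)).not_isUnit (hcop.isUnit_of_dvd' hc hd)
  exact ⟨f, h0, by rw [hd, mul_div_cancel_right₀ _ hc]⟩

lemma two_pow_eq_map_I_zpow (hp : p % 8 = 1) (hcd : (p : ℤ) = c ^ 2 + d ^ 2) (hc : c % 4 = 1)
    (hd : 4 ∣ d) (h0 : f ⟨c, d⟩ = 0) : (2 : ZMod p) ^ ((p - 1) / 8) =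
      f ⟨0, 1⟩ ^ (-((c + d - 1) / 4) - (c - 1) / 2 - ((p - 1) / 8 : ℕ)) := by
  have hN : (⟨c, d⟩ : GaussianInt).norm = p := (norm_mk c d).trans hcd.symm
  have hcop : IsCoprime c d := isCoprime_of_prime_eq Fact.out (by rw [hcd, one_mul])
  have ho := odd_norm_of_norm_eq (by omega) hN
  have hd2 : Even d := even_iff_two_dvd.2 (dvd_trans (by norm_num) hd)
  have hre := intCast_pow_eq_of_symbol_eq (by omega) hN h0 (a := c) (b := 1)
    (by rw [Int.cast_one, symbol_one_left ho, mul_one, symbol_re_mk hc hd2 hcop])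
  have hadd := intCast_pow_eq_of_symbol_eq (by omega) hN h0 (a := c + d) (b := 1)
    (by rw [Int.cast_one, symbol_one_left ho, mul_one, symbol_re_add_im_mk hc hd hcop])
  rw [Int.cast_one, one_pow, mul_one, show (p - 1) / 4 = 2 * ((p - 1) / 8) by omega] at hre hadd
  have hsq : ((c + d : ℤ) : ZMod p) ^ 2 = 2 * c ^ 2 * f ⟨0, 1⟩ := by
    rw [Int.cast_add, intCast_eq_map_I_mul h0]
    linear_combination (c : ZMod p) ^ 2 * map_I_sq f
  rw [pow_mul, hsq, mul_pow, mul_pow, ← pow_mul, hre, ← zpow_natCast (f _), mul_assoc,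
    ← zpow_add₀ map_I_ne_zero] at hadd
  rw [sub_sub, sub_eq_add_neg, zpow_add₀ map_I_ne_zero, ← hadd, zpow_neg,
    mul_inv_cancel_right₀ (zpow_ne_zero _ map_I_ne_zero)]

end Transfer

namespace PrimaryRepresentation

variable {q c d x y : ℤ} (h : PrimaryRepresentation q c d x y) {p : ℕ}
include h

lemma exponent_modEq_zero (hp : p % 8 = 1) (hq : Odd q) (hcd : (p : ℤ) = c ^ 2 + d ^ 2) :
    (x - 1) / 2 + d / 4 + y + (c + d - 1) / 4 + (c - 1) / 2 + ((p - 1) / 8 : ℕ) ≡ 0 [ZMOD 4] := by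
  have heq := h.eq
  obtain ⟨m, rfl⟩ : ∃ m, c = 4 * m + 1 := ⟨c / 4, by have := h.c_mod_four; omega⟩
  obtain ⟨w, rfl⟩ : ∃ w, x = 4 * w + 1 := ⟨x / 4, by have := h.x_mod_four; omega⟩
  obtain ⟨δ, rfl⟩ := h.four_dvd
  obtain ⟨η, rfl⟩ := h.even
  obtain ⟨j, rfl⟩ := hq
  have hN : (((p - 1) / 8 : ℕ) : ℤ) = 2 * m ^ 2 + m + 2 * δ ^ 2 := by
    have : (p : ℤ) = 8 * (2 * m ^ 2 + m + 2 * δ ^ 2) + 1 := by rw [hcd]; ring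
    omega
  obtain ⟨m', hm⟩ := Int.even_mul_succ_self m
  obtain ⟨δ', hδ⟩ := Int.even_mul_succ_self δ
  obtain ⟨η', hη⟩ := Int.even_mul_succ_self η
  rw [hN, show (4 * w + 1 - 1) / 2 = 2 * w by omega, show 4 * δ / 4 = δ by omega,
    show (4 * m + 1 + 4 * δ - 1) / 4 = m + δ by omega, show (4 * m + 1 - 1) / 2 = 2 * m by omega,
    Int.modEq_zero_iff_dvd]
  have heq' : 4 * m ^ 2 + 2 * m + 4 * δ ^ 2 = 4 * w ^ 2 + 2 * w + 2 * (2 * j + 1) * η ^ 2 := by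
    linarith
  exact ⟨m ^ 2 + m + m' + δ ^ 2 + δ' - w ^ 2 - j * η ^ 2 - η' + η, by
    linear_combination 2 * hm + 2 * hδ - 2 * hη - heq'⟩

lemma symbol_neg_of_mod_four_eq_one (hq : q % 4 = 1) {k : ℤ}
    (hk : symbol ⟨c, x + d⟩ q = Complex.I ^ k) :
    symbol (-q : ℤ) (divOneAddI c (x + d)) = Complex.I ^ (k + d / 2 + y - (q - 1) / 4) := by
  rw [symbol_mk_intCast h.c_mod_four h.add_mod_four hq, mul_comm, mul_I_zpow_eq_iff,
    ← zpow_add₀ Complex.I_ne_zero] at hk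
  rw [Int.cast_neg, neg_eq_neg_one_mul, symbol_mul_left h.odd_norm_divOneAddI,
    h.symbol_neg_one (Int.odd_iff.2 (by omega)), hk, ← zpow_add₀ Complex.I_ne_zero]
  congr 1
  ring

lemma symbol_neg_of_mod_four_eq_three (hq : q % 4 = 3) {k : ℤ}
    (hk : symbol ⟨c, x + d⟩ q = Complex.I ^ k) :
    symbol (-q : ℤ) (divOneAddI c (x + d)) = Complex.I ^ (k + (q + 1) / 4) := by
  rw [← symbol_neg_right, ← Int.cast_neg,
    symbol_mk_intCast h.c_mod_four h.add_mod_four (by omega : -q % 4 = 1), mul_comm,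
    mul_I_zpow_eq_iff, ← zpow_add₀ Complex.I_ne_zero] at hk
  rw [hk]
  congr 1
  omega

variable [Fact p.Prime]

lemma neg_pow_eq_of_symbol_eq (hp : p % 8 = 1) (hq : Odd q) (hcd : (p : ℤ) = c ^ 2 + d ^ 2) {e : ℤ}
    (he : symbol (-q : ℤ) (divOneAddI c (x + d)) = Complex.I ^ e) :
    ((-q : ℤ) : ZMod p) ^ ((p - 1) / 8) = ((d : ZMod p) / (c : ZMod p)) ^ e := by
  obtain ⟨f, h0, hf⟩ := exists_hom_zmod_map_I_eq_div (by omega) hcd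
  have hcop : IsCoprime c d := isCoprime_of_prime_eq Fact.out (by rw [hcd, one_mul])
  have hxy : (p : ℤ) = x ^ 2 + 2 * q * y ^ 2 := hcd.trans h.eq
  have hy : (y : ZMod p) ≠ 0 := intCast_ne_zero_of_prime_eq hxy
  have hsymbol := h.symbol_x hq hcop (by rintro rfl; exact hy Int.cast_zero)
  rw [he, ← zpow_add₀ Complex.I_ne_zero] at hsymbol
  have hpow := intCast_pow_eq_of_symbol_eq (by omega) ((norm_mk c d).trans hcd.symm) h0 hsymbol
  have hsq : (x : ZMod p) ^ 2 = (-q : ℤ) * 2 * (y : ZMod p) ^ 2 := by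
    have := congrArg (Int.cast : ℤ → ZMod p) hxy
    push_cast [CharP.cast_eq_zero] at this ⊢
    linear_combination -this
  rw [show (p - 1) / 4 = 2 * ((p - 1) / 8) by omega, pow_mul, hsq, mul_pow, ← pow_mul] at hpow
  have hpow' := mul_right_cancel₀ (pow_ne_zero _ hy) hpow
  rw [mul_pow, two_pow_eq_map_I_zpow hp hcd h.c_mod_four h.four_dvd h0] at hpow'
  rw [← hf]
  apply mul_right_cancel₀ (zpow_ne_zero _ map_I_ne_zero)
  rw [hpow', ← zpow_add₀ map_I_ne_zero]
  exact zpow_eq_zpow_of_sq_eq_neg_one (map_I_sq f)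
    (Int.modEq_of_dvd (by
      have := (h.exponent_modEq_zero hp hq hcd).dvd
      omega))

end PrimaryRepresentation

section BothRepresentations

variable {p : ℕ} {q c d x y k : ℤ}

lemma four_dvd_of_eq_sq_add_sq (hp : p % 8 = 1) (hcd : (p : ℤ) = c ^ 2 + d ^ 2) (hc : c % 4 = 1) :
    4 ∣ d := by
  obtain ⟨m, rfl⟩ : ∃ m, c = 4 * m + 1 := ⟨c / 4, by omega⟩
  rcases Int.even_or_odd' d with ⟨n, rfl | rfl⟩
  · rcases Int.even_or_odd' n with ⟨l, rfl | rfl⟩ <;> ring_nf at hcd <;> omega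
  · ring_nf at hcd
    omega

lemma odd_and_even_of_eq_sq_add (hp : p % 8 = 1) (hq : Odd q)
    (hxy : (p : ℤ) = x ^ 2 + 2 * q * y ^ 2) : Odd x ∧ Even y := by
  obtain ⟨j, rfl⟩ := hq
  rcases Int.even_or_odd' x with ⟨w, rfl | rfl⟩
  · ring_nf at hxy
    omega
  · obtain ⟨w', hw⟩ := Int.even_mul_succ_self w
    refine ⟨⟨w, rfl⟩, Int.not_odd_iff_even.1 ?_⟩
    rintro ⟨η, rfl⟩
    ring_nf at hxy hw
    omega

lemma exists_primaryRepresentation (hp : p % 8 = 1) (hq : Odd q) (hcd : (p : ℤ) = c ^ 2 + d ^ 2)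
    (hxy : (p : ℤ) = x ^ 2 + 2 * q * y ^ 2) (hc : c % 4 = 1) (hcop : IsCoprime c (x + d)) :
    PrimaryRepresentation q c d x y ∨ PrimaryRepresentation q c (-d) (-x) y := by
  have hd := four_dvd_of_eq_sq_add_sq hp hcd hc
  obtain ⟨⟨w, hw⟩, hy⟩ := odd_and_even_of_eq_sq_add hp hq hxy
  rcases (by omega : x % 4 = 1 ∨ -x % 4 = 1) with hx | hx
  · exact .inl ⟨hc, hx, hd, hy, hcd.symm.trans hxy, hcop⟩
  · exact .inr ⟨hc, hx, (dvd_neg).2 hd, hy, by linarith, by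
      rw [← neg_add]
      exact hcop.neg_right⟩

lemma symbol_mk_neg_add_neg (hq : Odd q) (hk : symbol ⟨c, x + d⟩ q = Complex.I ^ k) :
    symbol ⟨c, -x + -d⟩ q = Complex.I ^ (-k) := by
  rw [← star_I_zpow, ← hk, ← symbol_star (odd_norm_intCast hq), star_intCast, Zsqrtd.star_mk,
    neg_add]

variable [Fact p.Prime]

lemma div_sq_eq_neg_one (hp : p % 4 = 1) (hcd : (p : ℤ) = c ^ 2 + d ^ 2) :
    ((d : ZMod p) / c) ^ 2 = -1 := by
  obtain ⟨f, -, hf⟩ := exists_hom_zmod_map_I_eq_div hp hcd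
  rw [← hf, map_I_sq]

lemma intCast_neg_div_zpow (hp : p % 4 = 1) (hcd : (p : ℤ) = c ^ 2 + d ^ 2) (e : ℤ) :
    (((-d : ℤ) : ZMod p) / c) ^ e = ((d : ZMod p) / c) ^ (-e) := by
  have hneg : (-(d : ZMod p) / c) = ((d : ZMod p) / c)⁻¹ := by
    refine eq_inv_of_mul_eq_one_left ?_
    rw [neg_div, neg_mul, ← sq, div_sq_eq_neg_one hp hcd, neg_neg]
  rw [Int.cast_neg, hneg, inv_zpow']

lemma neg_pow_eq_of_mod_four_eq_one (hp : p % 8 = 1) (hq : q % 4 = 1)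
    (hcd : (p : ℤ) = c ^ 2 + d ^ 2) (hxy : (p : ℤ) = x ^ 2 + 2 * q * y ^ 2) (hc : c % 4 = 1)
    (hcop : IsCoprime c (x + d)) (hk : symbol ⟨c, x + d⟩ q = Complex.I ^ k) :
    ((-q : ℤ) : ZMod p) ^ ((p - 1) / 8) =
      ((d : ZMod p) / c) ^ (k + d / 2 + y - x * ((q - 1) / 4)) := by
  have hq2 : Odd q := Int.odd_iff.2 (by omega)
  have hι := div_sq_eq_neg_one (by omega) hcd
  rcases exists_primaryRepresentation hp hq2 hcd hxy hc hcop with h | h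
  · rw [h.neg_pow_eq_of_symbol_eq hp hq2 hcd (h.symbol_neg_of_mod_four_eq_one hq hk)]
    have hx : x ≡ 1 [ZMOD 4] := h.x_mod_four
    refine zpow_eq_zpow_of_sq_eq_neg_one hι (.sub_left _ ?_)
    simpa using (hx.mul_right ((q - 1) / 4)).symm
  · rw [h.neg_pow_eq_of_symbol_eq hp hq2 (by rw [hcd, neg_sq])
      (h.symbol_neg_of_mod_four_eq_one hq (symbol_mk_neg_add_neg hq2 hk)),
      intCast_neg_div_zpow (by omega) hcd]
    have hx := (show -x ≡ 1 [ZMOD 4] from h.x_mod_four).mul_right ((q - 1) / 4)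
    obtain ⟨δ, hδ⟩ := h.four_dvd
    obtain ⟨η, hη⟩ := h.even
    refine zpow_eq_zpow_of_sq_eq_neg_one hι ?_
    rw [neg_mul, one_mul] at hx
    simp only [Int.ModEq] at hx ⊢
    omega

lemma neg_pow_eq_of_mod_four_eq_three (hp : p % 8 = 1) (hq : q % 4 = 3)
    (hcd : (p : ℤ) = c ^ 2 + d ^ 2) (hxy : (p : ℤ) = x ^ 2 + 2 * q * y ^ 2) (hc : c % 4 = 1)
    (hcop : IsCoprime c (x + d)) (hk : symbol ⟨c, x + d⟩ q = Complex.I ^ k) :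
    ((-q : ℤ) : ZMod p) ^ ((p - 1) / 8) = ((d : ZMod p) / c) ^ (k + x * ((q + 1) / 4)) := by
  have hq2 : Odd q := Int.odd_iff.2 (by omega)
  have hι := div_sq_eq_neg_one (by omega) hcd
  rcases exists_primaryRepresentation hp hq2 hcd hxy hc hcop with h | h
  · rw [h.neg_pow_eq_of_symbol_eq hp hq2 hcd (h.symbol_neg_of_mod_four_eq_three hq hk)]
    have hx : x ≡ 1 [ZMOD 4] := h.x_mod_four
    refine zpow_eq_zpow_of_sq_eq_neg_one hι (.add_left _ ?_)
    simpa using (hx.mul_right ((q + 1) / 4)).symm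
  · rw [h.neg_pow_eq_of_symbol_eq hp hq2 (by rw [hcd, neg_sq])
      (h.symbol_neg_of_mod_four_eq_three hq (symbol_mk_neg_add_neg hq2 hk)),
      intCast_neg_div_zpow (by omega) hcd]
    have hx := (show -x ≡ 1 [ZMOD 4] from h.x_mod_four).mul_right ((q + 1) / 4)
    refine zpow_eq_zpow_of_sq_eq_neg_one hι ?_
    rw [neg_mul, one_mul] at hx
    simp only [Int.ModEq] at hx ⊢
    omega

end BothRepresentations

lemma symbol_mk_eq_of_symbolAddI_eq {a b q k : ℤ} (hab : IsCoprime a b) (hb : b ≠ 0) (hq : Odd q)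
    (h : symbolAddI ((a : ℚ) / b) ⟨q, 0⟩ = Complex.I ^ k) : symbol ⟨a, b⟩ q = Complex.I ^ k := by
  have hintCast (n : ℤ) : (⟨n, 0⟩ : GaussianInt) = (n : GaussianInt) := rfl
  have ho := odd_norm_intCast hq
  rw [symbolAddI, hintCast, hintCast] at h
  set t : ℚ := (a : ℚ) / b
  have hden : symbol ((t.den : ℤ) : GaussianInt) q = 1 := by
    refine symbol_intCast_of_isCoprime hq (by_contra fun hcop => ?_)
    rw [symbol_eq_zero (α := ((t.den : ℤ) : GaussianInt)) ho (mt isCoprime_intCast_iff.1 hcop),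
      div_zero] at h
    exact zpow_ne_zero _ Complex.I_ne_zero h.symm
  rw [hden, div_one] at h
  rw [← h]
  have hcop := Int.isCoprime_iff_nat_coprime.1 hab
  rcases lt_or_gt_of_ne hb with hneg | hpos
  · have ht : t = ((-a : ℤ) : ℚ) / ((-b : ℤ) : ℚ) := by
      rw [Int.cast_neg, Int.cast_neg, neg_div_neg_eq]
    have hcop' : (-a).natAbs.Coprime (-b).natAbs := by rwa [Int.natAbs_neg, Int.natAbs_neg]
    rw [ht, Rat.num_div_eq_of_coprime (by omega) hcop', Rat.den_div_eq_of_coprime (by omega) hcop',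
      show (⟨-a, -b⟩ : GaussianInt) = -1 * ⟨a, b⟩ by ext <;> simp, symbol_mul_left ho,
      symbol_neg_one_intCast hq, one_mul]
  · rw [Rat.num_div_eq_of_coprime hpos hcop, Rat.den_div_eq_of_coprime hpos hcop]

lemma mul_modEq_of_odd_of_even {a b : ℤ} (ha : Odd a) (hb : Even b) : a * b ≡ b [ZMOD 4] := by
  obtain ⟨s, rfl⟩ := ha
  obtain ⟨t, rfl⟩ := hb
  exact (Int.modEq_iff_dvd.2 ⟨s * t, by ring⟩).symm

lemma mul_modEq_of_odd_of_odd {a b : ℤ} (ha : Odd a) (hb : Odd b) :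
    a * b ≡ a + b - 1 [ZMOD 4] := by
  obtain ⟨s, rfl⟩ := ha
  obtain ⟨t, rfl⟩ := hb
  exact (Int.modEq_iff_dvd.2 ⟨s * t, by ring⟩).symm

end QuarticJacobi

open QuarticJacobi

theorem theorem4p1_general (p : ℕ) [Fact p.Prime] (hp : p % 8 = 1) (q : ℤ) (hq : Odd q)
    (c d x y : ℤ) (hcd : (p : ℤ) = c ^ 2 + d ^ 2) (hxy : (p : ℤ) = x ^ 2 + 2 * q * y ^ 2)
    (hc : c ≡ 1 [ZMOD 4]) (hgcd : Int.gcd c (x + d) = 1) (k : ℤ)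
    (hk : QuarticJacobi.symbolAddI ((c : ℚ) / ((x : ℚ) + (d : ℚ))) ⟨q, 0⟩ = Complex.I ^ k) :
    (q ≡ 1 [ZMOD 8] →
      ((-q : ℤ) : ZMod p) ^ ((p - 1) / 8) =
        (-1) ^ ((q - 1) / 8 + d / 4 + y / 2) * ((d : ZMod p) / (c : ZMod p)) ^ k) ∧
    (q ≡ 3 [ZMOD 8] →
      ((-q : ℤ) : ZMod p) ^ ((p - 1) / 8) =
        (-1) ^ ((q - 3) / 8 + (x - 1) / 2) * ((d : ZMod p) / (c : ZMod p)) ^ (k + 1)) ∧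
    (q ≡ 5 [ZMOD 8] →
      ((-q : ℤ) : ZMod p) ^ ((p - 1) / 8) =
        (-1) ^ ((q - 5) / 8 + d / 4 + (x - 1) / 2 + y / 2) *
          ((d : ZMod p) / (c : ZMod p)) ^ (k - 1)) ∧
    (q ≡ 7 [ZMOD 8] →
      ((-q : ℤ) : ZMod p) ^ ((p - 1) / 8) =
        (-1) ^ ((q + 1) / 8) * ((d : ZMod p) / (c : ZMod p)) ^ k) := by
  have h4d := four_dvd_of_eq_sq_add_sq hp hcd hc
  obtain ⟨hx, hy⟩ := odd_and_even_of_eq_sq_add hp hq hxy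
  have hcop := Int.isCoprime_iff_gcd_eq_one.2 hgcd
  have hne : x + d ≠ 0 := by
    have := Int.odd_iff.1 hx
    omega
  have hsymbol : symbol ⟨c, x + d⟩ q = Complex.I ^ k :=
    symbol_mk_eq_of_symbolAddI_eq hcop hne hq (by rwa [Int.cast_add])
  have h1 hq' := neg_pow_eq_of_mod_four_eq_one hp hq' hcd hxy hc hcop hsymbol
  have h3 hq' := neg_pow_eq_of_mod_four_eq_three hp hq' hcd hxy hc hcop hsymbol
  have hι := div_sq_eq_neg_one (by omega) hcd
  have heven {t : ℤ} (ht : t % 2 = 0) := mul_modEq_of_odd_of_even hx (Int.even_iff.2 ht)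
  have hodd {t : ℤ} (ht : t % 2 = 1) := mul_modEq_of_odd_of_odd hx (Int.odd_iff.2 ht)
  rw [Int.odd_iff] at hx
  rw [Int.even_iff] at hy
  simp only [Int.ModEq] at heven hodd ⊢
  refine ⟨fun h8 => ?_, fun h8 => ?_, fun h8 => ?_, fun h8 => ?_⟩
  · have := heven (t := (q - 1) / 4) (by omega)
    exact (h1 (by omega)).trans (neg_one_zpow_mul_zpow hι (show _ % _ = _ % _ by omega))
  · have := hodd (t := (q + 1) / 4) (by omega)
    exact (h3 (by omega)).trans (neg_one_zpow_mul_zpow hι (show _ % _ = _ % _ by omega))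
  · have := hodd (t := (q - 1) / 4) (by omega)
    exact (h1 (by omega)).trans (neg_one_zpow_mul_zpow hι (show _ % _ = _ % _ by omega))
  · have := heven (t := (q + 1) / 4) (by omega)
    exact (h3 (by omega)).trans (neg_one_zpow_mul_zpow hι (show _ % _ = _ % _ by omega))

theorem theorem4p1 (p : ℕ) [Fact p.Prime] (hp : p % 8 = 1)
    (q : ℤ) (hq : Odd q) (hpq : ¬ (p : ℤ) ∣ q)
    (c d x y : ℤ) (hcd : (p : ℤ) = c ^ 2 + d ^ 2) (hxy : (p : ℤ) = x ^ 2 + 2 * q * y ^ 2)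
    (hc : c ≡ 1 [ZMOD 4])
    (r : ℕ) (d₀ : ℤ) (hd : d = 2 ^ r * d₀) (hd₀ : d₀ ≡ 1 [ZMOD 4])
    (hgcd : Int.gcd c (x + d) = 1)
    (k : ℤ)
    (hk : QuarticJacobi.symbolAddI ((c : ℚ) / ((x : ℚ) + (d : ℚ))) ⟨q, 0⟩ = Complex.I ^ k) :
    (q ≡ 1 [ZMOD 8] →
      ((-q : ℤ) : ZMod p) ^ ((p - 1) / 8) =
        (-1) ^ ((q - 1) / 8 + d / 4 + y / 2) * ((d : ZMod p) / (c : ZMod p)) ^ k) ∧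
    (q ≡ 3 [ZMOD 8] →
      ((-q : ℤ) : ZMod p) ^ ((p - 1) / 8) =
        (-1) ^ ((q - 3) / 8 + (x - 1) / 2) * ((d : ZMod p) / (c : ZMod p)) ^ (k + 1)) ∧
    (q ≡ 5 [ZMOD 8] →
      ((-q : ℤ) : ZMod p) ^ ((p - 1) / 8) =
        (-1) ^ ((q - 5) / 8 + d / 4 + (x - 1) / 2 + y / 2) *
          ((d : ZMod p) / (c : ZMod p)) ^ (k - 1)) ∧
    (q ≡ 7 [ZMOD 8] →
      ((-q : ℤ) : ZMod p) ^ ((p - 1) / 8) =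
        (-1) ^ ((q + 1) / 8) * ((d : ZMod p) / (c : ZMod p)) ^ k) :=
  theorem4p1_general p hp q hq c d x y hcd hxy hc hgcd k hk
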